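/- Let $\mathbb K\in\{\mathbb R,\mathbb C\}$, let $\mathfrak k$ be a finite-dimensional Lie algebra over $\mathbb K$, and let $M$ be a finite-dimensional, Hausdorff, paracompact, connected smooth real manifold. Let $\pi:\mathbb L\to M$ be a bundle of Lie algebras with fiber $\mathfrak k$, i.e. a smooth vector bundle with fiber $\mathfrak k$ that has a bundle atlas whose transition maps take values in $\operatorname{Aut}(\mathfrak k)$; thus each fiber $\mathbb L_x$ is a Lie algebra isomorphic to $\mathfrak k$, and the bundle charts of this atlas (Lie charts) are Lie algebra isomorphisms on the fibers. Let $k\in\mathbb N=\{0,1,2,\dots\}$. Let $\Gamma^k(\mathbb L)$ be the $\mathbb K$-Lie algebra of $C^k$-sections of $\mathbb L$ with the pointwise bracket. Let $\operatorname{Der}(\mathbb L)$ be the vector bundle over $M$ with fiber $\operatorname{Der}(\mathbb L_x)$ at $x$ and with the bundle charts induced from the Lie charts of $\mathbb L$ by conjugation, and let $\Gamma^k(\operatorname{Der}(\mathbb L))$ be the Lie algebra of its $C^k$-sections with the pointwise commutator bracket. Theorem. Suppose that $\mathfrak k$ is perfect ($[\mathfrak k,\mathfrak k]=\mathfrak k$)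 or centerfree ($\mathfrak z(\mathfrak k)=0$). Then: 1. Every derivation $D$ of the Lie algebra $\Gamma^k(\mathbb L)$ is local: if $X\in\Gamma^k(\mathbb L)$ vanishes on an open set $U\subseteq M$, then so does $DX$. 2. Every derivation $D$ of $\Gamma^k(\mathbb L)$ is a differential operator of order zero: around every point of $M$ there are a bundle chart $(U,\varphi)$ of $\mathbb L$ and a $C^k$-map $f:U\to\operatorname{End}(\mathfrak k)$ such that $(DX)^\varphi(y)=f(y)\big(X^\varphi(y)\big)$ for all $X\in\Gamma^k(\mathbb L)$ and $y\in U$, where $X^\varphi:U\to\mathfrak k$ denotes the local form of $X$ in the chart. 3. There is an isomorphism of Lie algebras $\Psi:\operatorname{Der}(\Gamma^k(\mathbb L))\to\Gamma^k(\operatorname{Der}(\mathbb L))$ with $\Psi(D)_x(X_x)=(DX)_x$ for all derivations $D$, all $X\in\Gamma^k(\mathbb L)$ and all $x\in M$. -/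

import Mathlib

open Bundle
open scoped Manifold ContDiff

noncomputable section

namespace LieAlgebraBundle

/-! ### Pointwise Lie algebra structure on a product -/

section Pi

variable {ι : Type*} {A : ι → Type*} [∀ i, LieRing (A i)]

instance piLieRing : LieRing (∀ i, A i) where
  bracket X Y := fun i => ⁅X i, Y i⁆
  add_lie X Y Z := funext fun i => add_lie (X i) (Y i) (Z i)
  lie_add X Y Z := funext fun i => lie_add (X i) (Y i) (Z i)
  lie_self X := funext fun i => lie_self (X i)
  leibniz_lie X Y Z := funext fun i => leibniz_lie (X i) (Y i) (Z i)

instance piLieAlgebra {R : Type*} [CommRing R] [∀ i, LieAlgebra R (A i)] :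
    LieAlgebra R (∀ i, A i) where
  lie_smul c X Y := funext fun i => lie_smul c (X i) (Y i)

theorem pi_lie_apply (X Y : ∀ i, A i) (i : ι) : ⁅X, Y⁆ i = ⁅X i, Y i⁆ := rfl

end Pi

/-! ### Bundles of Lie algebras

`𝕂` is `ℝ` or `ℂ`, `M` is a real manifold modelled on `E`, and `L` is a family of `𝕂`-Lie algebras
indexed by `M` which is a smooth real vector bundle with model fibre `F`. The model fibre `F` is
the vector space underlying the Lie algebra `𝔨`, equipped with some norm; the identification of
`F` with `𝔨` is part of the notion of a Lie chart. -/

section Bundles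

variable (𝕂 : Type*) [RCLike 𝕂] (𝔨 : Type*) [LieRing 𝔨] [LieAlgebra 𝕂 𝔨]
  (E : Type*) [NormedAddCommGroup E] [NormedSpace ℝ E]
  {M : Type*} [TopologicalSpace M] [ChartedSpace E M]
  (F : Type*) [NormedAddCommGroup F] [NormedSpace ℝ F] [NormedSpace 𝕂 F]
  (L : M → Type*) [∀ x, LieRing (L x)] [∀ x, LieAlgebra 𝕂 (L x)]
  [∀ x, TopologicalSpace (L x)] [TopologicalSpace (TotalSpace F L)] [FiberBundle F L]

variable {F L} in
/-- A bundle chart: a fibrewise `𝕂`-linear local trivialization which is a diffeomorphism from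
`π⁻¹(U)` onto `U × F`. -/
structure IsBundleChart (e : Trivialization F (π F L)) : Prop where
  isLinear : e.IsLinear 𝕂
  contMDiffOn : ContMDiffOn (𝓘(ℝ, E).prod 𝓘(ℝ, F)) (𝓘(ℝ, E).prod 𝓘(ℝ, F)) ∞ e e.source
  contMDiffOn_symm : ContMDiffOn (𝓘(ℝ, E).prod 𝓘(ℝ, F)) (𝓘(ℝ, E).prod 𝓘(ℝ, F)) ∞
    e.toOpenPartialHomeomorph.symm e.target

variable {F L} in
/-- A Lie chart: a bundle chart which, after a linear identification `ψ` of the model fibre with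
`𝔨`, is an isomorphism of Lie algebras `L x ≅ 𝔨` on every fibre. The transition maps between Lie
charts take values in the isomorphisms of Lie algebras of `𝔨`. -/
structure IsLieChart (e : Trivialization F (π F L)) : Prop extends IsBundleChart 𝕂 E e where
  map_lie : ∃ ψ : F ≃ₗ[𝕂] 𝔨, ∀ x ∈ e.baseSet, ∀ v w : L x,
    ψ (e ⟨x, ⁅v, w⁆⟩).2 = ⁅ψ (e ⟨x, v⟩).2, ψ (e ⟨x, w⟩).2⁆

/-- `L` is a bundle of Lie algebras with fibre `𝔨`: the Lie charts form a bundle atlas. -/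
class IsLieAlgebraBundle : Prop where
  exists_isLieChart : ∀ x : M, ∃ e : Trivialization F (π F L), x ∈ e.baseSet ∧ IsLieChart 𝕂 𝔨 E e

end Bundles

section Sections

variable (𝕂 : Type*) [RCLike 𝕂] (𝔨 : Type*) [LieRing 𝔨] [LieAlgebra 𝕂 𝔨]
  {E : Type*} [NormedAddCommGroup E] [NormedSpace ℝ E]
  {M : Type*} [TopologicalSpace M] [ChartedSpace E M]
  {F : Type*} [NormedAddCommGroup F] [NormedSpace ℝ F] [NormedSpace 𝕂 F]
  [IsScalarTower ℝ 𝕂 F] [FiniteDimensional 𝕂 F]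
  {L : M → Type*} [∀ x, LieRing (L x)] [∀ x, LieAlgebra 𝕂 (L x)]
  [∀ x, TopologicalSpace (L x)] [TopologicalSpace (TotalSpace F L)] [FiberBundle F L]

variable {𝕂} in
/-- In a bundle chart, a section is `C^k` iff its local form is. -/
theorem IsBundleChart.contMDiffAt_iff {e : Trivialization F (π F L)}
    (he : IsBundleChart 𝕂 E e) (k : ℕ∞) (X : ∀ x, L x) {x : M} (hx : x ∈ e.baseSet) :
    ContMDiffAt 𝓘(ℝ, E) (𝓘(ℝ, E).prod 𝓘(ℝ, F)) k (fun y => TotalSpace.mk' F y (X y)) x ↔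
      ContMDiffAt 𝓘(ℝ, E) 𝓘(ℝ, F) k (fun y => (e ⟨y, X y⟩).2) x := by
  have hk : ((k : ℕ∞) : ℕ∞ω) ≤ (∞ : ℕ∞ω) := by exact_mod_cast le_top
  have hnhds : ∀ᶠ y in nhds x, y ∈ e.baseSet := e.open_baseSet.mem_nhds hx
  constructor
  · intro h
    have hsrc : (⟨x, X x⟩ : TotalSpace F L) ∈ e.source := e.mem_source.2 hx
    have h1 := ((he.contMDiffOn.of_le hk).contMDiffAt (e.open_source.mem_nhds hsrc)).comp x h
    exact contMDiffAt_snd.comp x h1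
  · intro h
    have htgt : (x, (e ⟨x, X x⟩).2) ∈ e.target := e.mem_target.2 hx
    have h1 : ContMDiffAt 𝓘(ℝ, E) (𝓘(ℝ, E).prod 𝓘(ℝ, F)) k
        (fun y => (y, (e ⟨y, X y⟩).2)) x := contMDiffAt_id.prodMk h
    have h2 := ((he.contMDiffOn_symm.of_le hk).contMDiffAt
      (e.open_target.mem_nhds htgt)).comp x h1
    refine h2.congr_of_eventuallyEq ?_
    filter_upwards [hnhds] with y hy
    have hy' : (⟨y, X y⟩ : TotalSpace F L) ∈ e.source := e.mem_source.2 hy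
    have h3 := e.left_inv hy'
    have h4 : e ⟨y, X y⟩ = (y, (e ⟨y, X y⟩).2) := Prod.ext (e.coe_fst hy') rfl
    change (⟨y, X y⟩ : TotalSpace F L) = e.toOpenPartialHomeomorph.symm (y, (e ⟨y, X y⟩).2)
    rw [← h4]
    exact h3.symm

variable (E F L) in
/-- `Γ^k(L)`: the Lie algebra of `C^k`-sections of `L`, with the pointwise operations. -/
def sections [IsLieAlgebraBundle 𝕂 𝔨 E F L] (k : ℕ∞) : LieSubalgebra 𝕂 (∀ x, L x) where
  carrier := {X | ContMDiff 𝓘(ℝ, E) (𝓘(ℝ, E).prod 𝓘(ℝ, F)) k fun x => TotalSpace.mk' F x (X x)}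
  add_mem' {X Y} hX hY := by
    intro x
    obtain ⟨e, hx, he⟩ := IsLieAlgebraBundle.exists_isLieChart (𝕂 := 𝕂) (𝔨 := 𝔨) (E := E)
      (F := F) (L := L) x
    have hb := he.toIsBundleChart
    rw [hb.contMDiffAt_iff k _ hx]
    refine (((hb.contMDiffAt_iff k X hx).1 (hX x)).add
      ((hb.contMDiffAt_iff k Y hx).1 (hY x))).congr_of_eventuallyEq ?_
    filter_upwards [e.open_baseSet.mem_nhds hx] with y hy
    exact (hb.isLinear.linear y hy).map_add (X y) (Y y)
  zero_mem' := by
    intro x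
    obtain ⟨e, hx, he⟩ := IsLieAlgebraBundle.exists_isLieChart (𝕂 := 𝕂) (𝔨 := 𝔨) (E := E)
      (F := F) (L := L) x
    have hb := he.toIsBundleChart
    rw [hb.contMDiffAt_iff k _ hx]
    refine (contMDiffAt_const (c := (0 : F))).congr_of_eventuallyEq ?_
    filter_upwards [e.open_baseSet.mem_nhds hx] with y hy
    exact (hb.isLinear.linear y hy).map_zero
  smul_mem' c X hX := by
    intro x
    obtain ⟨e, hx, he⟩ := IsLieAlgebraBundle.exists_isLieChart (𝕂 := 𝕂) (𝔨 := 𝔨) (E := E)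
      (F := F) (L := L) x
    have hb := he.toIsBundleChart
    rw [hb.contMDiffAt_iff k _ hx]
    have hc : ContDiff ℝ k (fun v : F => c • v) :=
      ((c • ContinuousLinearMap.id 𝕂 F).restrictScalars ℝ).contDiff
    refine (hc.contMDiff.contMDiffAt.comp x
      ((hb.contMDiffAt_iff k X hx).1 (hX x))).congr_of_eventuallyEq ?_
    filter_upwards [e.open_baseSet.mem_nhds hx] with y hy
    exact (hb.isLinear.linear y hy).map_smul c (X y)
  lie_mem' {X Y} hX hY := by
    intro x
    obtain ⟨e, hx, he⟩ := IsLieAlgebraBundle.exists_isLieChart (𝕂 := 𝕂) (𝔨 := 𝔨) (E := E)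
      (F := F) (L := L) x
    have hb := he.toIsBundleChart
    obtain ⟨ψ, hψ⟩ := he.map_lie
    rw [hb.contMDiffAt_iff k _ hx]
    let β : F →ₗ[𝕂] F →ₗ[𝕂] F :=
      LinearMap.mk₂ 𝕂 (fun a b => ψ.symm ⁅ψ a, ψ b⁆) (by simp) (by simp) (by simp) (by simp)
    have hβ : ContDiff ℝ k (fun p : F × F => β p.1 p.2) :=
      (β.toContinuousBilinearMap.bilinearRestrictScalars ℝ).isBoundedBilinearMap.contDiff
    refine (hβ.contMDiff.contMDiffAt.comp x
      (((hb.contMDiffAt_iff k X hx).1 (hX x)).prodMk_space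
        ((hb.contMDiffAt_iff k Y hx).1 (hY x)))).congr_of_eventuallyEq ?_
    filter_upwards [e.open_baseSet.mem_nhds hx] with y hy
    change _ = ψ.symm ⁅ψ _, ψ _⁆
    rw [← hψ y hy, LinearEquiv.symm_apply_apply]
    rfl

/-- The local form `y ↦ e_y ∘ D_y ∘ e_y⁻¹` (for `y` in the domain of the chart) of a family of
linear endomorphisms of the fibres. -/
def localForm (e : Trivialization F (π F L)) (he : e.IsLinear 𝕂) (D : ∀ x, L x →ₗ[𝕂] L x)
    (y : M) : F →L[𝕂] F :=
  LinearMap.toContinuousLinearMap (e.linearMapAt 𝕂 y ∘ₗ D y ∘ₗ e.symmₗ 𝕂 y)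

variable (E F L) in
/-- `Γ^k(Der(L))`: the Lie algebra of `C^k`-sections of the bundle `Der(L)`, whose fibre at `x` is
`Der(L x)` and whose bundle charts are induced by conjugation from the Lie charts of `L`: a section
is `C^k` iff its local forms in Lie charts are. (The local forms take values in the linear subspace
of `End(F)` which corresponds to `Der(𝔨)`.) -/
def derSections (k : ℕ∞) : LieSubalgebra 𝕂 (∀ x, LieDerivation 𝕂 (L x) (L x)) where
  carrier := {D | ∀ (e : Trivialization F (π F L)) (he : IsLieChart 𝕂 𝔨 E e),
    ContMDiffOn 𝓘(ℝ, E) 𝓘(ℝ, F →L[𝕂] F) k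
      (localForm 𝕂 e he.isLinear fun x => (D x : L x →ₗ[𝕂] L x)) e.baseSet}
  add_mem' {D D'} hD hD' := by
    intro e he
    refine ((hD e he).add (hD' e he)).congr fun y _ => ?_
    ext v
    simp [localForm]
  zero_mem' := by
    intro e he
    refine (contMDiffOn_const (c := (0 : F →L[𝕂] F))).congr fun y _ => ?_
    ext v
    simp [localForm]
  smul_mem' c D hD := by
    intro e he
    have hc : ContDiff ℝ k (fun A : F →L[𝕂] F => c • A) :=
      ((c • ContinuousLinearMap.id 𝕂 (F →L[𝕂] F)).restrictScalars ℝ).contDiff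
    refine (hc.contMDiff.comp_contMDiffOn (hD e he)).congr fun y _ => ?_
    ext v
    simp [localForm]
  lie_mem' {D D'} hD hD' := by
    intro e he
    have hm : ContDiff ℝ k (fun p : (F →L[𝕂] F) × (F →L[𝕂] F) => p.1.comp p.2) :=
      ((ContinuousLinearMap.compL 𝕂 F F F).bilinearRestrictScalars ℝ).isBoundedBilinearMap.contDiff
    have h1 := hm.contMDiff.comp_contMDiffOn ((hD e he).prodMk_space (hD' e he))
    have h2 := hm.contMDiff.comp_contMDiffOn ((hD' e he).prodMk_space (hD e he))
    refine (h1.sub h2).congr fun y hy => ?_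
    have := he.isLinear
    ext v
    simp [localForm, pi_lie_apply, LieDerivation.commutator_coe_linear_map,
      LieRing.of_associative_ring_bracket, Module.End.mul_apply,
      Trivialization.symmₗ_linearMapAt _ hy]

section Operators

variable {𝕂 𝔨} [IsLieAlgebraBundle 𝕂 𝔨 E F L] {k : ℕ∞}

/-- A linear operator on sections is local if `TX` vanishes on every open set on which `X`
vanishes. -/
def IsLocalOperator (T : sections 𝕂 𝔨 E F L k →ₗ[𝕂] sections 𝕂 𝔨 E F L k) : Prop :=
  ∀ (X : sections 𝕂 𝔨 E F L k) (U : Set M), IsOpen U →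
    (∀ x ∈ U, X.1 x = 0) → ∀ x ∈ U, (T X).1 x = 0

/-- A linear operator on `C^k`-sections is a differential operator of order zero if around every
point there are a bundle chart and a `C^k` map `f` from its domain into the endomorphisms of the
model fibre such that `(TX)^e = f · X^e` on the domain for every section `X`. -/
def IsDiffOpOrderZero (T : sections 𝕂 𝔨 E F L k →ₗ[𝕂] sections 𝕂 𝔨 E F L k) : Prop :=
  ∀ x : M, ∃ e : Trivialization F (π F L), x ∈ e.baseSet ∧ IsBundleChart 𝕂 E e ∧
    ∃ f : M → F →L[𝕂] F, ContMDiffOn 𝓘(ℝ, E) 𝓘(ℝ, F →L[𝕂] F) k f e.baseSet ∧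
      ∀ X : sections 𝕂 𝔨 E F L k, ∀ y ∈ e.baseSet,
        (e ⟨y, (T X).1 y⟩).2 = f y (e ⟨y, X.1 y⟩).2

end Operators

end Sections

end LieAlgebraBundle

end

section

open Set Filter Topology

/-! The whole theorem reduces to one claim: a derivation `D` commutes with multiplication by real
`C^k`-functions. Granting this, expand a section near a point in a local frame with cut-off
coefficients; if the section vanishes at the point, so do its coefficients, hence so does its image
under `D` (`derivation_apply_eq_zero`). So `D` acts fibre by fibre, and locality, order zero and the
isomorphism with sections of `Der(L)` follow.

For the claim, consider the `defect` `D(fX) - f D(X)`. As an operator in `X` it lies in the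
centroid: it can be moved into either slot of a bracket. Playing the two slots against each other
shows that it commutes with functions on all brackets. This extends to all sections if the sections
form a perfect Lie algebra, or if the fibres are centerfree. Then the defect, now as an operator in
`f`, satisfies the Leibniz rule with values in `C^k`-sections.

Such a rule is trivial because `k` is finite (`leibniz_eq_zero`); for smooth functions, vector
fields would be counterexamples. The test function is `u^k |u|`, which is `C^k`: a nonzero
derivation would send it to a `C^k`-function that looks like `sgn(u) u^k` up to a nonvanishing
`C^k`-factor, which is impossible. For `k = 0` a continuous function vanishing at a point is a
product of two such functions.

Perfectness of the fibres passes to global sections because finitely many sections span every fibre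
(`exists_sections_realSpans`, by a generic perturbation argument). Their brackets then span every
fibre, and every section is a finite combination of these brackets with `C^k`-coefficients, which
can be absorbed into one slot of each bracket. -/

/-! ### Topology: σ-compactness of the base. -/

/-- In a locally finite cover by relatively compact open sets each member meets only finitely many
others, so chains starting at one member reach only countably many. Their union is clopen. -/
theorem sigmaCompactSpace_of_connected_paracompact (X : Type*) [TopologicalSpace X] [T2Space X]
    [LocallyCompactSpace X] [ParacompactSpace X] [ConnectedSpace X] : SigmaCompactSpace X := by
  choose K hKc hKn using fun x : X => exists_compact_mem_nhds x
  obtain ⟨V, hVo, hVu, hVf, hVK⟩ := precise_refinement (fun x => interior (K x))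
    (fun x => isOpen_interior)
    (iUnion_eq_univ_iff.2 fun x => ⟨x, mem_interior_iff_mem_nhds.2 (hKn x)⟩)
  have hfin : ∀ i, {j | (V j ∩ K i).Nonempty}.Finite := fun i =>
    hVf.finite_nonempty_inter_compact (hKc i)
  obtain ⟨i₀⟩ : Nonempty X := inferInstance
  obtain ⟨j₀, hj₀⟩ := mem_iUnion.1 (hVu ▸ mem_univ i₀ : i₀ ∈ ⋃ i, V i)
  -- Indices reached after `n` steps, where a step goes from `i` to any `j` whose set meets the
  -- compact set `K i`.
  let A : ℕ → Set X := fun n => Nat.rec {j₀} (fun _ B => ⋃ i ∈ B, {j | (V j ∩ K i).Nonempty}) n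
  have hA : ∀ n, (A n).Countable := by
    intro n
    induction n with
    | zero => exact countable_singleton j₀
    | succ n ih => exact ih.biUnion fun i _ => (hfin i).countable
  have hAu : (⋃ n, A n).Countable := countable_iUnion hA
  let S : Set X := ⋃ i ∈ ⋃ n, A n, V i
  have hSo : IsOpen S := isOpen_biUnion fun i _ => hVo i
  have hSc : IsClosed S := by
    rw [← closure_subset_iff_isClosed]
    intro x hx
    obtain ⟨j, hj⟩ := mem_iUnion.1 (hVu ▸ mem_univ x : x ∈ ⋃ i, V i)
    obtain ⟨y, hyj, hyS⟩ := mem_closure_iff.1 hx _ (hVo j) hj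
    obtain ⟨i, hi, hyi⟩ := mem_iUnion₂.1 hyS
    obtain ⟨n, hn⟩ := mem_iUnion.1 hi
    refine mem_iUnion₂.2 ⟨j, mem_iUnion.2 ⟨n + 1, ?_⟩, hj⟩
    exact mem_iUnion₂.2 ⟨i, hn, y, hyj, interior_subset (hVK i hyi)⟩
  have hSne : S.Nonempty :=
    ⟨i₀, mem_iUnion₂.2 ⟨j₀, mem_iUnion.2 ⟨0, mem_singleton j₀⟩, hj₀⟩⟩
  have hSu : S = univ := IsClopen.eq_univ ⟨hSc, hSo⟩ hSne
  refine SigmaCompactSpace.of_countable (K '' ⋃ n, A n) (hAu.image K) ?_ ?_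
  · rintro _ ⟨i, -, rfl⟩
    exact hKc i
  · refine eq_univ_of_forall fun x => ?_
    obtain ⟨i, hi, hx⟩ := mem_iUnion₂.1 (hSu ▸ mem_univ x : x ∈ S)
    exact ⟨K i, mem_image_of_mem K hi, interior_subset (hVK i hx)⟩

/-! ### Calculus on the line: the functions `t^k |t|` and `sgn(t) t^k`. -/

theorem hasDerivAt_pow_succ_mul_abs (n : ℕ) (t : ℝ) :
    HasDerivAt (fun t : ℝ => t ^ (n + 1) * |t|) ((n + 2) * (t ^ n * |t|)) t := by
  rcases lt_trichotomy t 0 with ht | rfl | ht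
  · refine (((hasDerivAt_pow (n + 2) t).neg).congr_deriv ?_).congr_of_eventuallyEq ?_
    · rw [abs_of_neg ht, Nat.add_sub_assoc (by norm_num)]; push_cast; ring
    · filter_upwards [Iio_mem_nhds ht] with s hs
      rw [abs_of_neg hs]; simp; ring
  · rw [hasDerivAt_iff_tendsto_slope_zero]
    have h1 : Tendsto (fun t : ℝ => t ^ n * |t|) (𝓝[≠] 0) (𝓝 ((0 : ℝ) ^ n * |0|)) :=
      ((continuous_pow n).mul continuous_abs).continuousAt.tendsto.mono_left nhdsWithin_le_nhds
    have h2 : ((n : ℝ) + 2) * (0 ^ n * |0|) = 0 ^ n * |0| := by simp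
    rw [h2]
    refine h1.congr' ?_
    filter_upwards [self_mem_nhdsWithin] with t ht
    have ht' : t ≠ 0 := ht
    simp only [zero_add, abs_zero, mul_zero, sub_zero, smul_eq_mul]
    field_simp
    ring
  · refine ((hasDerivAt_pow (n + 2) t).congr_deriv ?_).congr_of_eventuallyEq ?_
    · rw [abs_of_pos ht, Nat.add_sub_assoc (by norm_num)]; push_cast; ring
    · filter_upwards [Ioi_mem_nhds ht] with s hs
      rw [abs_of_pos hs]; ring

theorem contDiff_pow_mul_abs (n : ℕ) : ContDiff ℝ n (fun t : ℝ => t ^ n * |t|) := by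
  induction n with
  | zero => exact contDiff_zero.2 (by fun_prop)
  | succ n ih =>
    push_cast
    rw [contDiff_succ_iff_deriv]
    refine ⟨fun t => (hasDerivAt_pow_succ_mul_abs n t).differentiableAt, by simp, ?_⟩
    rw [funext fun t => (hasDerivAt_pow_succ_mul_abs n t).deriv]
    exact contDiff_const.mul ih

/-- The derivatives up to order `k` vanish on the right of `0`, hence at `0` by continuity, so the
Taylor polynomial of order `k` is zero. -/
theorem isLittleO_pow_of_contDiffAt_of_eq_zero {h : ℝ → ℝ} {k : ℕ} (hh : ContDiffAt ℝ k h 0)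
    (h0 : ∀ᶠ t in 𝓝[>] (0 : ℝ), h t = 0) : h =o[𝓝 0] fun t => t ^ k := by
  obtain ⟨u, hu, hhu⟩ := hh.contDiffOn (le_refl _) (by simp)
  obtain ⟨ε, hε, hεu⟩ := Metric.mem_nhds_iff.1 hu
  set s := Metric.ball (0 : ℝ) ε with hs
  have hso : IsOpen s := Metric.isOpen_ball
  have h0s : (0 : ℝ) ∈ s := Metric.mem_ball_self hε
  have hhs : ContDiffOn ℝ k h s := hhu.mono hεu
  have hz : ∀ j ≤ k, iteratedDerivWithin j h s 0 = 0 := by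
    intro j hj
    have hc := (hhs.continuousOn_iteratedDerivWithin (m := j) (by exact_mod_cast hj)
      hso.uniqueDiffOn).continuousAt (hso.mem_nhds h0s)
    have h1 : Tendsto (iteratedDerivWithin j h s) (𝓝[>] 0) (𝓝 (iteratedDerivWithin j h s 0)) :=
      hc.tendsto.mono_left nhdsWithin_le_nhds
    refine tendsto_nhds_unique h1 (tendsto_const_nhds.congr' ?_)
    filter_upwards [eventually_eventually_nhdsWithin.2 h0,
      nhdsWithin_le_nhds (hso.mem_nhds h0s), self_mem_nhdsWithin] with t ht hts ht0
    rw [iteratedDerivWithin_of_isOpen hso hts]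
    have : h =ᶠ[𝓝 t] fun _ => (0 : ℝ) := by
      rwa [IsOpen.nhdsWithin_eq isOpen_Ioi ht0] at ht
    rw [this.iteratedDeriv_eq]
    simp
  have ht := taylor_isLittleO (convex_ball (0 : ℝ) ε) h0s hhs
  rw [hso.nhdsWithin_eq h0s] at ht
  refine (ht.congr_left fun t => ?_).congr_right fun t => by simp
  rw [taylor_within_apply, Finset.sum_eq_zero, sub_zero]
  intro j hj
  rw [hz j (Nat.lt_succ_iff.1 (Finset.mem_range.1 hj)), smul_zero]

/-- The difference `g - w^k` vanishes on the right of `0`, so if `g` were `C^k` it would be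
`o(t^k)`. On the left it equals `-2 w^k`, which is asymptotic to `-2 w'^k t^k`. -/
theorem not_contDiffAt_of_eq_pow_of_eq_neg_pow {g w : ℝ → ℝ} {w' : ℝ} {k : ℕ}
    (hw : ContDiffAt ℝ k w 0) (hw0 : w 0 = 0) (hw' : HasDerivAt w w' 0) (hpos : 0 < w')
    (hgp : ∀ᶠ t in 𝓝 0, 0 < w t → g t = w t ^ k)
    (hgn : ∀ᶠ t in 𝓝 0, w t < 0 → g t = -w t ^ k) : ¬ ContDiffAt ℝ k g 0 := by
  intro hg
  have hsl : Tendsto (fun t => w t / t) (𝓝[≠] 0) (𝓝 w') := by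
    refine (hasDerivAt_iff_tendsto_slope_zero.1 hw').congr fun t => ?_
    simp [hw0, div_eq_inv_mul]
  have hev : ∀ᶠ t in 𝓝[≠] (0 : ℝ), 0 < w t / t := hsl.eventually (lt_mem_nhds hpos)
  have hr : (𝓝[>] (0 : ℝ)) ≤ 𝓝[≠] 0 := nhdsWithin_mono _ fun t ht => ne_of_gt ht
  have hl : (𝓝[<] (0 : ℝ)) ≤ 𝓝[≠] 0 := nhdsWithin_mono _ fun t ht => ne_of_lt ht
  have h1 : (fun t => g t - w t ^ k) =o[𝓝 0] fun t => t ^ k := by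
    refine isLittleO_pow_of_contDiffAt_of_eq_zero (hg.sub (hw.pow k)) ?_
    filter_upwards [hr hev, nhdsWithin_le_nhds hgp, self_mem_nhdsWithin] with t h1 h2 h3
    rw [h2, sub_self]
    exact (div_pos_iff_of_pos_right h3).1 h1
  have h2 : (fun t => -2 * w t ^ k) =o[𝓝[<] 0] fun t => t ^ k := by
    refine (h1.mono nhdsWithin_le_nhds).congr' ?_ EventuallyEq.rfl
    filter_upwards [hl hev, nhdsWithin_le_nhds hgn, self_mem_nhdsWithin] with t h1 h2 h3
    rw [h2]
    · ring
    · have h3' : t < 0 := h3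
      by_contra hc
      exact absurd h1 (not_lt.2 (div_nonpos_of_nonneg_of_nonpos (not_lt.1 hc) h3'.le))
  have h3 := h2.tendsto_div_nhds_zero
  have h4 : Tendsto (fun t => -2 * w t ^ k / t ^ k) (𝓝[<] 0) (𝓝 (-2 * w' ^ k)) := by
    refine (((hsl.mono_left hl).pow k).const_mul (-2)).congr fun t => ?_
    rw [div_pow, mul_div_assoc]
  have h5 := tendsto_nhds_unique h3 h4
  have := pow_pos hpos k
  linarith

/-! ### Derivations of the algebra of `C^k`-functions. -/

section

variable {E : Type*} [NormedAddCommGroup E] [NormedSpace ℝ E] [FiniteDimensional ℝ E]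
  {M : Type*} [TopologicalSpace M] [ChartedSpace E M] [IsManifold 𝓘(ℝ, E) ∞ M] [T2Space M]

/-- A smooth bump function at `x`, supported in a given neighbourhood of `x`. -/
theorem exists_contMDiff_bump (n : ℕ∞) {x : M} {U : Set M} (hU : U ∈ 𝓝 x) :
    ∃ χ : C^n⟮𝓘(ℝ, E), M; ℝ⟯, χ =ᶠ[𝓝 x] 1 ∧ tsupport χ ⊆ U := by
  obtain ⟨f, -, hf⟩ := (SmoothBumpFunction.nhds_basis_tsupport (I := 𝓘(ℝ, E)) x).mem_iff.1 hU
  exact ⟨⟨f, f.contMDiff.of_le (by exact_mod_cast le_top)⟩, f.eventuallyEq_one, hf⟩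

section Scalar

variable {n : ℕ∞} {d : C^n⟮𝓘(ℝ, E), M; ℝ⟯ →ₗ[ℝ] (M → ℝ)}
  (hd : ∀ f g q, d (f * g) q = f q * d g q + g q * d f q)
include hd

/-- Locality: with a bump `χ` supported where `f = g`, one has `f - g = (1 - χ)(f - g)`, a product
of two functions vanishing at `q`. -/
theorem leibniz_eq_of_eventuallyEq {f g : C^n⟮𝓘(ℝ, E), M; ℝ⟯} {q : M} (h : f =ᶠ[𝓝 q] g) :
    d f q = d g q := by
  obtain ⟨χ, hχ1, hχ⟩ := exists_contMDiff_bump (E := E) n h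
  have h1 : f - g = (1 - χ) * (f - g) := by
    ext y
    change f y - g y = (1 - χ y) * (f y - g y)
    by_cases hy : y ∈ tsupport χ
    · have : f y = g y := hχ hy
      simp [this]
    · rw [image_eq_zero_of_notMem_tsupport hy]; ring
  have h2 : d (f - g) q = 0 := by
    rw [h1, hd]
    change (1 - χ q) * _ + (f q - g q) * _ = 0
    rw [hχ1.eq_of_nhds, h.eq_of_nhds]; simp
  rw [map_sub, Pi.sub_apply] at h2
  linarith

omit [FiniteDimensional ℝ E] [IsManifold 𝓘(ℝ, E) ∞ M] [T2Space M] in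
theorem leibniz_const (c : ℝ) (q : M) : d (c • (1 : C^n⟮𝓘(ℝ, E), M; ℝ⟯)) q = 0 := by
  have h := hd 1 1 q
  rw [mul_one] at h
  have h1 : (1 : C^n⟮𝓘(ℝ, E), M; ℝ⟯) q = 1 := rfl
  rw [h1] at h
  rw [map_smul, Pi.smul_apply, smul_eq_mul]
  have : d 1 q = 0 := by linarith
  rw [this, mul_zero]

omit [FiniteDimensional ℝ E] [IsManifold 𝓘(ℝ, E) ∞ M] [T2Space M] in
theorem leibniz_pow (f : C^n⟮𝓘(ℝ, E), M; ℝ⟯) (m : ℕ) (q : M) :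
    d (f ^ (m + 1)) q = (m + 1) * f q ^ m * d f q := by
  induction m with
  | zero => simp
  | succ m ih =>
    rw [pow_succ, hd, ih]
    have : (f ^ (m + 1)) q = f q ^ (m + 1) := rfl
    rw [this]; push_cast; ring

end Scalar

section Finite

variable {k : ℕ} {d : C^(k : ℕ∞)⟮𝓘(ℝ, E), M; ℝ⟯ →ₗ[ℝ] (M → ℝ)}
  (hd : ∀ f g q, d (f * g) q = f q * d g q + g q * d f q)
include hd

/-- By locality and the power rule, `d` sends `u^k |u|` to `±(k+1) u^k d u` where `±u > 0`. If `d u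
p ≠ 0`, dividing by `(k+1) d u` along the curve leaves a `C^k`-function equal to `±u^k`, against
`not_contDiffAt_of_eq_pow_of_eq_neg_pow`. -/
theorem leibniz_eq_zero_of_hasDerivAt_pos {p : M}
    (hs : ∀ f, ContMDiffAt 𝓘(ℝ, E) 𝓘(ℝ, ℝ) (k : ℕ∞) (d f) p) {γ : ℝ → M} (hγp : γ 0 = p)
    (hγ : ContMDiffAt 𝓘(ℝ, ℝ) 𝓘(ℝ, E) (k : ℕ∞) γ 0) {u : C^(k : ℕ∞)⟮𝓘(ℝ, E), M; ℝ⟯} (hu : u p = 0)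
    {w' : ℝ} (hw' : HasDerivAt (fun t => u (γ t)) w' 0) (hpos : 0 < w') : d u p = 0 := by
  by_contra hne
  subst hγp
  let Fu : C^(k : ℕ∞)⟮𝓘(ℝ, E), M; ℝ⟯ := ⟨fun y => u y ^ k * |u y|,
    (contDiff_pow_mul_abs k).contMDiff.comp u.contMDiff⟩
  have hcomp : ∀ f : M → ℝ, ContMDiffAt 𝓘(ℝ, E) 𝓘(ℝ, ℝ) (k : ℕ∞) f (γ 0) →
      ContDiffAt ℝ k (fun t => f (γ t)) 0 := fun f hf => (hf.comp 0 hγ).contDiffAt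
  have hk1 : ((k : ℝ) + 1) ≠ 0 := by positivity
  have hcont : ContinuousAt (fun t => d u (γ t)) 0 := (hcomp _ (hs u)).continuousAt
  have hγc : ContinuousAt γ 0 := hγ.continuousAt
  have hne' : ∀ᶠ t in 𝓝 0, d u (γ t) ≠ 0 := hcont.eventually_ne hne
  refine not_contDiffAt_of_eq_pow_of_eq_neg_pow (g := fun t => d Fu (γ t) / ((k + 1) * d u (γ t)))
    (hcomp u u.contMDiff.contMDiffAt) hu hw' hpos ?_ ?_ ?_
  · filter_upwards [hne'] with t h1 h2
    have : d Fu (γ t) = d (u ^ (k + 1)) (γ t) := by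
      refine leibniz_eq_of_eventuallyEq hd ?_
      filter_upwards [u.contMDiff.continuous.continuousAt.eventually (lt_mem_nhds h2)] with y hy
      change u y ^ k * |u y| = u y ^ (k + 1)
      rw [abs_of_pos hy, pow_succ]
    rw [this, leibniz_pow hd]
    field_simp
  · filter_upwards [hne'] with t h1 h2
    have : d Fu (γ t) = d (-(u ^ (k + 1))) (γ t) := by
      refine leibniz_eq_of_eventuallyEq hd ?_
      filter_upwards [u.contMDiff.continuous.continuousAt.eventually (gt_mem_nhds h2)] with y hy
      change u y ^ k * |u y| = -(u y ^ (k + 1))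
      rw [abs_of_neg hy, pow_succ]; ring
    rw [this, map_neg, Pi.neg_apply, leibniz_pow hd]
    field_simp
  · refine (hcomp _ (hs Fu)).div (contDiffAt_const.mul (hcomp _ (hs u))) ?_
    exact mul_ne_zero hk1 hne

/-- A derivation of the algebra of `C^k`-functions, `k` finite, vanishes. -/
theorem leibniz_eq_zero {p : M}
    (hs : ∀ f, ContMDiffAt 𝓘(ℝ, E) 𝓘(ℝ, ℝ) (k : ℕ∞) (d f) p) (u : C^(k : ℕ∞)⟮𝓘(ℝ, E), M; ℝ⟯) :
    d u p = 0 := by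
  suffices H : ∀ u : C^(k : ℕ∞)⟮𝓘(ℝ, E), M; ℝ⟯, u p = 0 → d u p = 0 by
    have h1 := H (u - u p • 1) (by
      change u p - u p * 1 = 0
      ring)
    rwa [map_sub, Pi.sub_apply, leibniz_const hd, sub_zero] at h1
  intro u hu
  rcases Nat.eq_zero_or_pos k with rfl | hk
  -- For `k = 0`, factor `u` as `√|u|` times the signed root `sgn(u) √|u|`; both factors vanish at
  -- `p`.
  · let a : C^((0 : ℕ) : ℕ∞)⟮𝓘(ℝ, E), M; ℝ⟯ := ⟨fun y => Real.sqrt |u y|, by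
      have := u.contMDiff.continuous
      exact contMDiff_zero_iff.2 (by fun_prop)⟩
    let b : C^((0 : ℕ) : ℕ∞)⟮𝓘(ℝ, E), M; ℝ⟯ :=
      ⟨fun y => Real.sqrt (max (u y) 0) - Real.sqrt (max (-u y) 0), by
      have := u.contMDiff.continuous
      exact contMDiff_zero_iff.2 (by fun_prop)⟩
    have hab : u = a * b := by
      ext y
      change u y = Real.sqrt |u y| * (Real.sqrt (max (u y) 0) - Real.sqrt (max (-u y) 0))
      rcases le_total 0 (u y) with h | h
      · simp [abs_of_nonneg h, h]
      · have h' : 0 ≤ -u y := by linarith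
        simp [abs_of_nonpos h, h, Real.mul_self_sqrt h']
    have ha : a p = 0 := by change Real.sqrt |u p| = 0; simp [hu]
    have hb : b p = 0 := by
      change Real.sqrt (max (u p) 0) - Real.sqrt (max (-u p) 0) = 0; simp [hu]
    rw [hab, hd, ha, hb]; ring
  · have hk1 : (1 : ℕ∞ω) ≤ ((k : ℕ∞) : ℕ∞ω) := by exact_mod_cast hk
    have hk_top : ((k : ℕ∞) : ℕ∞ω) ≤ (∞ : ℕ∞ω) := by exact_mod_cast le_top
    set φ := chartAt E p with hφ
    have hps : p ∈ φ.source := mem_chart_source E p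
    rcases subsingleton_or_nontrivial E with hE | hE
    -- In dimension zero `p` is isolated, so `u` vanishes near `p`.
    · rw [leibniz_eq_of_eventuallyEq hd (g := 0), map_zero, Pi.zero_apply]
      filter_upwards [φ.open_source.mem_nhds hps] with q hq
      rw [φ.injOn hq hps (Subsingleton.elim _ _), hu]; rfl
    · obtain ⟨v, hv⟩ := exists_ne (0 : E)
      obtain ⟨ℓ, hℓ⟩ := SeparatingDual.exists_eq_one (R := ℝ) hv
      -- A coordinate line through `p`; below, `x` is a cut-off coordinate function with `x (γ t) =
      -- t` for small `t`.
      let γ : ℝ → M := fun t => φ.symm (φ p + t • v)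
      have hγp : γ 0 = p := by simp [γ, hps]
      have hline : Continuous fun t : ℝ => φ p + t • v := by fun_prop
      have hγ_top : ContMDiffAt 𝓘(ℝ, ℝ) 𝓘(ℝ, E) ∞ γ 0 := by
        have h1 : ContMDiffAt 𝓘(ℝ, E) 𝓘(ℝ, E) ∞ φ.symm (φ p + (0 : ℝ) • v) := by
          refine contMDiffOn_chart_symm.contMDiffAt (φ.open_target.mem_nhds ?_)
          simpa using φ.map_source hps
        refine h1.comp (0 : ℝ) (ContDiff.contMDiff ?_).contMDiffAt
        fun_prop
      have hγ : ContMDiffAt 𝓘(ℝ, ℝ) 𝓘(ℝ, E) (k : ℕ∞) γ 0 := hγ_top.of_le hk_top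
      obtain ⟨χ, hχ1, hχ⟩ := exists_contMDiff_bump (E := E) (k : ℕ∞)
        (φ.open_source.mem_nhds hps)
      let x : C^(k : ℕ∞)⟮𝓘(ℝ, E), M; ℝ⟯ := ⟨fun y => χ y * ℓ (φ y - φ p), by
        refine contMDiff_of_tsupport (f := fun y => χ y * ℓ (φ y - φ p)) fun y hy => ?_
        have hy' : y ∈ φ.source := hχ (tsupport_mul_subset_left hy)
        refine χ.contMDiff.contMDiffAt.mul ?_
        have h1 : ContMDiffAt 𝓘(ℝ, E) 𝓘(ℝ, E) (k : ℕ∞) φ y :=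
          (contMDiffOn_chart.contMDiffAt (φ.open_source.mem_nhds hy')).of_le hk_top
        have h2 : ContDiff ℝ (k : ℕ∞) fun z : E => ℓ (z - φ p) := by fun_prop
        exact h2.contMDiff.contMDiffAt.comp y h1⟩
      have hxp : x p = 0 := by change χ p * ℓ (φ p - φ p) = 0; simp
      have hx' : HasDerivAt (fun t => x (γ t)) 1 0 := by
        refine (hasDerivAt_id (0 : ℝ)).congr_of_eventuallyEq ?_
        have h1 : ∀ᶠ t in 𝓝 (0 : ℝ), χ (γ t) = 1 :=
          (hγp ▸ hγ.continuousAt.tendsto : Tendsto γ (𝓝 0) (𝓝 p)).eventually hχ1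
        have h2 : ∀ᶠ t in 𝓝 (0 : ℝ), φ p + t • v ∈ φ.target :=
          hline.continuousAt.eventually (φ.open_target.mem_nhds
            (by simpa using φ.map_source hps))
        filter_upwards [h1, h2] with t ht1 ht2
        change χ (γ t) * ℓ (φ (φ.symm (φ p + t • v)) - φ p) = t
        rw [ht1, φ.right_inv ht2]
        simp [hℓ]
      have hu' : DifferentiableAt ℝ (fun t => u (γ t)) 0 := by
        have : ContMDiffAt 𝓘(ℝ, ℝ) 𝓘(ℝ, ℝ) (k : ℕ∞) (fun t => u (γ t)) 0 :=
          u.contMDiff.contMDiffAt.comp 0 hγ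
        exact this.contDiffAt.differentiableAt (by exact_mod_cast hk.ne')
      have hx0 := leibniz_eq_zero_of_hasDerivAt_pos hd hs hγp hγ hxp hx' one_pos
      set s := deriv (fun t => u (γ t)) 0 with hsdef
      -- The coefficient `1 - s` makes the derivative along `γ` equal to `s + (1 - s) = 1`, so the
      -- positive-derivative case applies; the contribution of `x` is already known to vanish.
      have h1 : d (u + (1 - s) • x) p = 0 := by
        refine leibniz_eq_zero_of_hasDerivAt_pos hd hs hγp hγ (w' := 1) ?_ ?_ one_pos
        · change u p + (1 - s) * x p = 0
          rw [hu, hxp]; ring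
        · have := hu'.hasDerivAt.add (hx'.const_mul (1 - s))
          refine this.congr_deriv ?_
          rw [← hsdef]; ring
      rw [map_add, map_smul, Pi.add_apply, Pi.smul_apply, hx0, smul_zero, add_zero] at h1
      exact h1

end Finite

end

namespace LieAlgebraBundle

/-! ### Bundle charts on fibres. -/

section Charts

variable {𝕂 : Type*} [RCLike 𝕂] {𝔨 : Type*} [LieRing 𝔨] [LieAlgebra 𝕂 𝔨]
  {E : Type*} [NormedAddCommGroup E] [NormedSpace ℝ E]
  {M : Type*} [TopologicalSpace M] [ChartedSpace E M]
  {F : Type*} [NormedAddCommGroup F] [NormedSpace ℝ F] [NormedSpace 𝕂 F]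
  {L : M → Type*} [∀ x, LieRing (L x)] [∀ x, LieAlgebra 𝕂 (L x)]
  [∀ x, TopologicalSpace (L x)] [TopologicalSpace (TotalSpace F L)] [FiberBundle F L]
  {e : Trivialization F (π F L)} {y : M}

/-- A bundle chart as a linear isomorphism on a fibre. -/
noncomputable def IsBundleChart.fibreEquiv (he : IsBundleChart 𝕂 E e) (hy : y ∈ e.baseSet) :
    L y ≃ₗ[𝕂] F :=
  haveI := he.isLinear
  e.linearEquivAt 𝕂 y hy

theorem IsBundleChart.fibreEquiv_apply (he : IsBundleChart 𝕂 E e) (hy : y ∈ e.baseSet) (v : L y) :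
    he.fibreEquiv hy v = (e ⟨y, v⟩).2 := rfl

theorem IsBundleChart.fibreEquiv_symm_apply (he : IsBundleChart 𝕂 E e) (hy : y ∈ e.baseSet)
    (v : F) : (he.fibreEquiv hy).symm v = e.symm y v := rfl

theorem IsLieChart.exists_equiv (he : IsLieChart 𝕂 𝔨 E e) (hy : y ∈ e.baseSet) :
    Nonempty (L y ≃ₗ⁅𝕂⁆ 𝔨) := by
  obtain ⟨ψ, hψ⟩ := he.map_lie
  exact ⟨{ (he.toIsBundleChart.fibreEquiv hy).trans ψ with
    map_lie' := fun {v w} => hψ y hy v w }⟩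

variable (𝕂 𝔨 E F L) in
theorem exists_lieEquiv [IsLieAlgebraBundle 𝕂 𝔨 E F L] (y : M) : Nonempty (L y ≃ₗ⁅𝕂⁆ 𝔨) := by
  obtain ⟨e, hy, he⟩ := IsLieAlgebraBundle.exists_isLieChart (𝕂 := 𝕂) (𝔨 := 𝔨) (E := E)
    (F := F) (L := L) y
  exact he.exists_equiv hy

end Charts

/-! ### Sections as a module over `C^k`-functions. -/

section Sections

variable {𝕂 : Type*} [RCLike 𝕂] {𝔨 : Type*} [LieRing 𝔨] [LieAlgebra 𝕂 𝔨]
  {E : Type*} [NormedAddCommGroup E] [NormedSpace ℝ E]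
  {M : Type*} [TopologicalSpace M] [ChartedSpace E M]
  {F : Type*} [NormedAddCommGroup F] [NormedSpace ℝ F] [NormedSpace 𝕂 F]
  [IsScalarTower ℝ 𝕂 F] [FiniteDimensional 𝕂 F]
  {L : M → Type*} [∀ x, LieRing (L x)] [∀ x, LieAlgebra 𝕂 (L x)]
  [∀ x, TopologicalSpace (L x)] [TopologicalSpace (TotalSpace F L)] [FiberBundle F L]
  [IsLieAlgebraBundle 𝕂 𝔨 E F L] {k : ℕ∞}

omit [FiniteDimensional 𝕂 F] [IsLieAlgebraBundle 𝕂 𝔨 E F L] in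
theorem IsBundleChart.fibreEquiv_ofReal_smul {e : Trivialization F (π F L)} {y : M}
    (he : IsBundleChart 𝕂 E e) (hy : y ∈ e.baseSet) (r : ℝ) (v : L y) :
    he.fibreEquiv hy ((r : 𝕂) • v) = r • he.fibreEquiv hy v := by
  rw [map_smul, RCLike.real_smul_eq_coe_smul (K := 𝕂)]

theorem mem_sections_iff {X : ∀ x, L x} : X ∈ sections 𝕂 𝔨 E F L k ↔
    ∀ x, ∃ e : Trivialization F (π F L), x ∈ e.baseSet ∧ IsBundleChart 𝕂 E e ∧
      ContMDiffAt 𝓘(ℝ, E) 𝓘(ℝ, F) k (fun y => (e ⟨y, X y⟩).2) x := by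
  constructor
  · intro hX x
    obtain ⟨e, hx, he⟩ := IsLieAlgebraBundle.exists_isLieChart (𝕂 := 𝕂) (𝔨 := 𝔨) (E := E)
      (F := F) (L := L) x
    exact ⟨e, hx, he.toIsBundleChart, (he.toIsBundleChart.contMDiffAt_iff k X hx).1 (hX x)⟩
  · intro h x
    obtain ⟨e, hx, he, h⟩ := h x
    exact (he.contMDiffAt_iff k X hx).2 h

theorem contMDiffAt_localForm (X : sections 𝕂 𝔨 E F L k) {e : Trivialization F (π F L)}
    (he : IsBundleChart 𝕂 E e) {x : M} (hx : x ∈ e.baseSet) :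
    ContMDiffAt 𝓘(ℝ, E) 𝓘(ℝ, F) k (fun y => (e ⟨y, X.1 y⟩).2) x :=
  (he.contMDiffAt_iff k X.1 hx).1 (X.2 x)

/-- Two families which agree near a point are simultaneously sections there. -/
theorem mem_sections_of_eventuallyEq {X : ∀ x, L x}
    (h : ∀ x, ∃ Y : sections 𝕂 𝔨 E F L k, ∀ᶠ y in 𝓝 x, X y = Y.1 y) :
    X ∈ sections 𝕂 𝔨 E F L k := by
  intro x
  obtain ⟨Y, hY⟩ := h x
  refine ContMDiffAt.congr_of_eventuallyEq (Y.2 x) ?_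
  filter_upwards [hY] with y hy
  rw [hy]

/-- The product of a real function and a section. -/
noncomputable def fsmul (f : C^k⟮𝓘(ℝ, E), M; ℝ⟯) (X : sections 𝕂 𝔨 E F L k) :
    sections 𝕂 𝔨 E F L k :=
  ⟨fun y => (f y : 𝕂) • X.1 y, by
    rw [mem_sections_iff]
    intro x
    obtain ⟨e, hx, he, h⟩ := mem_sections_iff.1 X.2 x
    refine ⟨e, hx, he, (f.contMDiff.contMDiffAt.smul h).congr_of_eventuallyEq ?_⟩
    filter_upwards [e.open_baseSet.mem_nhds hx] with y hy
    exact he.fibreEquiv_ofReal_smul hy _ _⟩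

theorem fsmul_apply (f : C^k⟮𝓘(ℝ, E), M; ℝ⟯) (X : sections 𝕂 𝔨 E F L k) (y : M) :
    (fsmul f X).1 y = (f y : 𝕂) • X.1 y := rfl

theorem sections_ext {X Y : sections 𝕂 𝔨 E F L k} (h : ∀ y, X.1 y = Y.1 y) :
    X = Y := Subtype.ext (funext h)

theorem lie_apply (X Y : sections 𝕂 𝔨 E F L k) (y : M) : ⁅X, Y⁆.1 y = ⁅X.1 y, Y.1 y⁆ := rfl
theorem add_apply (X Y : sections 𝕂 𝔨 E F L k) (y : M) : (X + Y).1 y = X.1 y + Y.1 y := rfl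
theorem sub_apply (X Y : sections 𝕂 𝔨 E F L k) (y : M) : (X - Y).1 y = X.1 y - Y.1 y := rfl
theorem zero_apply (y : M) : (0 : sections 𝕂 𝔨 E F L k).1 y = 0 := rfl
theorem smul_apply (c : 𝕂) (X : sections 𝕂 𝔨 E F L k) (y : M) : (c • X).1 y = c • X.1 y := rfl

variable (𝕂 𝔨 E F L k) in
/-- Evaluation of sections at a point. -/
def evalAt (y : M) : sections 𝕂 𝔨 E F L k →ₗ[𝕂] L y where
  toFun X := X.1 y
  map_add' _ _ := rfl
  map_smul' _ _ := rfl

theorem sum_apply {ι : Type*} (s : Finset ι) (X : ι → sections 𝕂 𝔨 E F L k) (y : M) :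
    (∑ i ∈ s, X i).1 y = ∑ i ∈ s, (X i).1 y := map_sum (evalAt 𝕂 𝔨 E F L k y) X s

theorem fsmul_add (f : C^k⟮𝓘(ℝ, E), M; ℝ⟯) (X Y : sections 𝕂 𝔨 E F L k) :
    fsmul f (X + Y) = fsmul f X + fsmul f Y :=
  sections_ext fun _ => smul_add _ _ _

theorem fsmul_sub (f : C^k⟮𝓘(ℝ, E), M; ℝ⟯) (X Y : sections 𝕂 𝔨 E F L k) :
    fsmul f (X - Y) = fsmul f X - fsmul f Y :=
  sections_ext fun _ => smul_sub _ _ _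

theorem fsmul_smul (f : C^k⟮𝓘(ℝ, E), M; ℝ⟯) (c : 𝕂) (X : sections 𝕂 𝔨 E F L k) :
    fsmul f (c • X) = c • fsmul f X :=
  sections_ext fun _ => smul_comm _ _ _

theorem add_fsmul (f g : C^k⟮𝓘(ℝ, E), M; ℝ⟯) (X : sections 𝕂 𝔨 E F L k) :
    fsmul (f + g) X = fsmul f X + fsmul g X :=
  sections_ext fun y => by
    change ((f y + g y : ℝ) : 𝕂) • X.1 y = (f y : 𝕂) • X.1 y + (g y : 𝕂) • X.1 y
    rw [RCLike.ofReal_add, add_smul]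

theorem mul_fsmul (f g : C^k⟮𝓘(ℝ, E), M; ℝ⟯) (X : sections 𝕂 𝔨 E F L k) :
    fsmul (f * g) X = fsmul f (fsmul g X) :=
  sections_ext fun y => by
    change ((f y * g y : ℝ) : 𝕂) • X.1 y = (f y : 𝕂) • (g y : 𝕂) • X.1 y
    rw [RCLike.ofReal_mul, mul_smul]

theorem smul_fsmul (r : ℝ) (f : C^k⟮𝓘(ℝ, E), M; ℝ⟯) (X : sections 𝕂 𝔨 E F L k) :
    fsmul (r • f) X = (r : 𝕂) • fsmul f X :=
  sections_ext fun y => by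
    change ((r * f y : ℝ) : 𝕂) • X.1 y = (r : 𝕂) • (f y : 𝕂) • X.1 y
    rw [RCLike.ofReal_mul, mul_smul]

theorem fsmul_lie (f : C^k⟮𝓘(ℝ, E), M; ℝ⟯) (X Y : sections 𝕂 𝔨 E F L k) :
    ⁅fsmul f X, Y⁆ = fsmul f ⁅X, Y⁆ :=
  sections_ext fun _ => smul_lie _ _ _

theorem lie_fsmul (f : C^k⟮𝓘(ℝ, E), M; ℝ⟯) (X Y : sections 𝕂 𝔨 E F L k) :
    ⁅X, fsmul f Y⁆ = fsmul f ⁅X, Y⁆ :=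
  sections_ext fun _ => lie_smul _ _ _

/-- The section with local form `χ • v` in a bundle chart `e`, if `χ` is supported in the domain of
the chart. -/
noncomputable def cutoffSection {e : Trivialization F (π F L)} (he : IsBundleChart 𝕂 E e)
    (χ : C^k⟮𝓘(ℝ, E), M; ℝ⟯) (hχ : tsupport χ ⊆ e.baseSet) (v : M → F)
    (hv : ContMDiffOn 𝓘(ℝ, E) 𝓘(ℝ, F) k v e.baseSet) : sections 𝕂 𝔨 E F L k :=
  ⟨fun y => (χ y : 𝕂) • e.symm y (v y), by
    rw [mem_sections_iff]
    intro x
    by_cases hx : x ∈ e.baseSet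
    · refine ⟨e, hx, he, (χ.contMDiff.contMDiffAt.smul
        (hv.contMDiffAt (e.open_baseSet.mem_nhds hx))).congr_of_eventuallyEq ?_⟩
      filter_upwards [e.open_baseSet.mem_nhds hx] with y hy
      rw [← he.fibreEquiv_apply hy, he.fibreEquiv_ofReal_smul hy, ← he.fibreEquiv_symm_apply hy,
        LinearEquiv.apply_symm_apply]
      rfl
    · obtain ⟨e', hx', he', h⟩ :=
        mem_sections_iff.1 (0 : sections 𝕂 𝔨 E F L k).2 x
      refine ⟨e', hx', he', h.congr_of_eventuallyEq ?_⟩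
      filter_upwards [(isClosed_tsupport χ).isOpen_compl.mem_nhds fun h => hx (hχ h)] with y hy
      rw [image_eq_zero_of_notMem_tsupport hy]
      simp [zero_apply]⟩

theorem cutoffSection_apply {e : Trivialization F (π F L)} (he : IsBundleChart 𝕂 E e)
    (χ : C^k⟮𝓘(ℝ, E), M; ℝ⟯) (hχ : tsupport χ ⊆ e.baseSet) (v : M → F)
    (hv : ContMDiffOn 𝓘(ℝ, E) 𝓘(ℝ, F) k v e.baseSet) {y : M} (hy : y ∈ e.baseSet) :
    (e ⟨y, (cutoffSection (𝔨 := 𝔨) he χ hχ v hv).1 y⟩).2 = χ y • v y := by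
  rw [← he.fibreEquiv_apply hy]
  change he.fibreEquiv hy ((χ y : 𝕂) • e.symm y (v y)) = _
  rw [he.fibreEquiv_ofReal_smul hy, ← he.fibreEquiv_symm_apply hy, LinearEquiv.apply_symm_apply]

theorem cutoffSection_eq_zero {e : Trivialization F (π F L)} (he : IsBundleChart 𝕂 E e)
    (χ : C^k⟮𝓘(ℝ, E), M; ℝ⟯) (hχ : tsupport χ ⊆ e.baseSet) (v : M → F)
    (hv : ContMDiffOn 𝓘(ℝ, E) 𝓘(ℝ, F) k v e.baseSet) {y : M} (hy : χ y = 0) :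
    (cutoffSection (𝔨 := 𝔨) he χ hχ v hv).1 y = 0 := by
  change (χ y : 𝕂) • e.symm y (v y) = 0
  rw [hy, RCLike.ofReal_zero, zero_smul]

variable [FiniteDimensional ℝ E] [IsManifold 𝓘(ℝ, E) ∞ M] [T2Space M]

variable (𝔨 k) in
/-- A constant vector in a chart extends, near a given point, to a global section. -/
theorem exists_section_eventually_eq {e : Trivialization F (π F L)} (he : IsBundleChart 𝕂 E e)
    {x : M} (hx : x ∈ e.baseSet) (v : F) :
    ∃ X : sections 𝕂 𝔨 E F L k, ∀ᶠ y in 𝓝 x, (e ⟨y, X.1 y⟩).2 = v := by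
  obtain ⟨χ, h1, hs⟩ := exists_contMDiff_bump (E := E) k (e.open_baseSet.mem_nhds hx)
  refine ⟨cutoffSection he χ hs (fun _ => v) contMDiffOn_const, ?_⟩
  filter_upwards [h1, e.open_baseSet.mem_nhds hx] with y hy hye
  rw [cutoffSection_apply he χ hs _ _ hye, hy, Pi.one_apply, one_smul]

variable (𝕂 𝔨 E F k) in
theorem exists_section_apply_eq (x : M) (v : L x) :
    ∃ X : sections 𝕂 𝔨 E F L k, X.1 x = v := by
  obtain ⟨e, hx, he⟩ := IsLieAlgebraBundle.exists_isLieChart (𝕂 := 𝕂) (𝔨 := 𝔨) (E := E)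
    (F := F) (L := L) x
  have hb := he.toIsBundleChart
  obtain ⟨X, hX⟩ := exists_section_eventually_eq 𝔨 k hb hx (hb.fibreEquiv hx v)
  exact ⟨X, (hb.fibreEquiv hx).injective hX.self_of_nhds⟩

/-! ### Derivations commute with multiplication by functions -/

section Derivation

variable (D : LieDerivation 𝕂 (sections 𝕂 𝔨 E F L k) (sections 𝕂 𝔨 E F L k))

/-- The defect of linearity over functions of a derivation. -/
noncomputable def defect (f : C^k⟮𝓘(ℝ, E), M; ℝ⟯) (X : sections 𝕂 𝔨 E F L k) :
    sections 𝕂 𝔨 E F L k := D (fsmul f X) - fsmul f (D X)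

omit [FiniteDimensional ℝ E] [IsManifold 𝓘(ℝ, E) ∞ M] [T2Space M]

theorem defect_add (f : C^k⟮𝓘(ℝ, E), M; ℝ⟯) (X Y : sections 𝕂 𝔨 E F L k) :
    defect D f (X + Y) = defect D f X + defect D f Y := by
  simp only [defect, fsmul_add, map_add]; abel

theorem defect_smul (f : C^k⟮𝓘(ℝ, E), M; ℝ⟯) (c : 𝕂) (X : sections 𝕂 𝔨 E F L k) :
    defect D f (c • X) = c • defect D f X := by
  simp only [defect, fsmul_smul, map_smul, smul_sub]

/-- Expand `D[fX, Y]` and `f D[X, Y]` by the Leibniz rule: the terms containing `D Y` cancel. With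
`defect_lie_right`, this puts the defect in the centroid. -/
theorem defect_lie_left (f : C^k⟮𝓘(ℝ, E), M; ℝ⟯) (X Y : sections 𝕂 𝔨 E F L k) :
    defect D f ⁅X, Y⁆ = ⁅defect D f X, Y⁆ := by
  have h1 : fsmul f ⁅X, Y⁆ = ⁅fsmul f X, Y⁆ := (fsmul_lie f X Y).symm
  simp only [defect]
  rw [h1, LieDerivation.apply_lie_eq_add, LieDerivation.apply_lie_eq_add, fsmul_add, fsmul_lie,
    sub_lie, fsmul_lie]
  abel

theorem defect_lie_right (f : C^k⟮𝓘(ℝ, E), M; ℝ⟯) (X Y : sections 𝕂 𝔨 E F L k) :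
    defect D f ⁅X, Y⁆ = ⁅X, defect D f Y⁆ := by
  have h1 : fsmul f ⁅X, Y⁆ = ⁅X, fsmul f Y⁆ := (lie_fsmul f X Y).symm
  simp only [defect]
  rw [h1, LieDerivation.apply_lie_eq_add, LieDerivation.apply_lie_eq_add, fsmul_add, lie_fsmul,
    lie_sub, lie_fsmul]
  abel

/-- Put `g` into the left slot, let the defect act on the right slot, and pull `g` out again. -/
theorem defect_fsmul_lie (f g : C^k⟮𝓘(ℝ, E), M; ℝ⟯) (X Y : sections 𝕂 𝔨 E F L k) :
    defect D f (fsmul g ⁅X, Y⁆) = fsmul g (defect D f ⁅X, Y⁆) := by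
  rw [← fsmul_lie, defect_lie_right, fsmul_lie, defect_lie_right]

theorem defect_fsmul_of_span
    (hspan : ∀ X : sections 𝕂 𝔨 E F L k, X ∈ Submodule.span 𝕂
      (range fun p : sections 𝕂 𝔨 E F L k × sections 𝕂 𝔨 E F L k => ⁅p.1, p.2⁆))
    (f g : C^k⟮𝓘(ℝ, E), M; ℝ⟯) (X : sections 𝕂 𝔨 E F L k) :
    defect D f (fsmul g X) = fsmul g (defect D f X) := by
  have h0 : defect D f (fsmul g 0) = fsmul g (defect D f 0) := by
    have h := defect_fsmul_lie D f g 0 0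
    rwa [lie_zero] at h
  induction hspan X using Submodule.span_induction with
  | mem x h => obtain ⟨p, rfl⟩ := h; exact defect_fsmul_lie D f g _ _
  | zero => exact h0
  | add x y _ _ hx hy => rw [fsmul_add, defect_add, hx, hy, defect_add, fsmul_add]
  | smul c x _ hx => rw [fsmul_smul, defect_smul, hx, defect_smul, fsmul_smul]

/-- Linearity over functions turns one summand into a defect of a multiple of `X`, after which the
sum telescopes. -/
theorem defect_mul (hlin : ∀ (f g : C^k⟮𝓘(ℝ, E), M; ℝ⟯) (X : sections 𝕂 𝔨 E F L k),
      defect D f (fsmul g X) = fsmul g (defect D f X))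
    (f g : C^k⟮𝓘(ℝ, E), M; ℝ⟯) (X : sections 𝕂 𝔨 E F L k) :
    defect D (f * g) X = fsmul f (defect D g X) + fsmul g (defect D f X) := by
  have hcomm : ∀ Y : sections 𝕂 𝔨 E F L k, fsmul f (fsmul g Y) = fsmul g (fsmul f Y) := fun Y => by
    rw [← mul_fsmul, mul_comm, mul_fsmul]
  rw [← hlin]
  simp only [defect, mul_fsmul, fsmul_sub]
  rw [hcomm X, hcomm (D X)]
  abel

theorem defect_add_left (f g : C^k⟮𝓘(ℝ, E), M; ℝ⟯) (X : sections 𝕂 𝔨 E F L k) :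
    defect D (f + g) X = defect D f X + defect D g X := by
  simp only [defect, add_fsmul, map_add]; abel

theorem defect_smul_left (r : ℝ) (f : C^k⟮𝓘(ℝ, E), M; ℝ⟯) (X : sections 𝕂 𝔨 E F L k) :
    defect D (r • f) X = (r : 𝕂) • defect D f X := by
  simp only [defect, smul_fsmul, map_smul, smul_sub]

end Derivation

/-- The bracket of the difference of the two sides with any section vanishes, since the defect
commutes with functions on brackets. Sections take arbitrary values at `x`, so the difference is
central there. -/
theorem defect_fsmul_of_center (D : LieDerivation 𝕂 (sections 𝕂 𝔨 E F L k) (sections 𝕂 𝔨 E F L k))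
    (hc : ∀ (x : M) (v : L x), (∀ w : L x, ⁅v, w⁆ = 0) → v = 0)
    (f g : C^k⟮𝓘(ℝ, E), M; ℝ⟯) (X : sections 𝕂 𝔨 E F L k) :
    defect D f (fsmul g X) = fsmul g (defect D f X) := by
  refine sections_ext fun x => sub_eq_zero.1 (hc x _ fun w => ?_)
  obtain ⟨Y, rfl⟩ := exists_section_apply_eq 𝕂 𝔨 E F k x w
  have h : ⁅defect D f (fsmul g X) - fsmul g (defect D f X), Y⁆ = 0 := by
    rw [sub_lie, ← defect_lie_left, fsmul_lie, fsmul_lie, ← defect_lie_left, defect_fsmul_lie,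
      sub_self]
  exact congrArg (fun Z : sections 𝕂 𝔨 E F L k => Z.1 x) h

/-- A derivation whose defect is linear over functions is itself linear over functions. -/
theorem derivation_fsmul {k : ℕ}
    (D : LieDerivation 𝕂 (sections 𝕂 𝔨 E F L k) (sections 𝕂 𝔨 E F L k))
    (hlin : ∀ (f g : C^(k : ℕ∞)⟮𝓘(ℝ, E), M; ℝ⟯) (X : sections 𝕂 𝔨 E F L k),
      defect D f (fsmul g X) = fsmul g (defect D f X))
    (f : C^(k : ℕ∞)⟮𝓘(ℝ, E), M; ℝ⟯) (X : sections 𝕂 𝔨 E F L k) :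
    D (fsmul f X) = fsmul f (D X) := by
  refine sections_ext fun x => sub_eq_zero.1 ?_
  change (defect D f X).1 x = 0
  obtain ⟨e, hx, he⟩ := IsLieAlgebraBundle.exists_isLieChart (𝕂 := 𝕂) (𝔨 := 𝔨) (E := E)
    (F := F) (L := L) x
  have hb := he.toIsBundleChart
  have := hb.isLinear
  refine (hb.fibreEquiv hx).map_eq_zero_iff.1 ?_
  have hfd : FiniteDimensional ℝ F := FiniteDimensional.trans ℝ 𝕂 F
  rw [← Module.forall_dual_apply_eq_zero_iff ℝ]
  intro ξ
  have hreal : ∀ (y : M) (r : ℝ) (v : L y),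
      e.linearMapAt 𝕂 y ((r : 𝕂) • v) = r • e.linearMapAt 𝕂 y v := fun y r v => by
    rw [map_smul, RCLike.real_smul_eq_coe_smul (K := 𝕂)]
  -- Since `linearMapAt` is zero off the chart domain, `d` is defined and satisfies the Leibniz rule
  -- on all of `M`, while its values are only claimed to be `C^k` at `x`. This is why
  -- `leibniz_eq_zero` asks for regularity at one point only.
  let d : C^(k : ℕ∞)⟮𝓘(ℝ, E), M; ℝ⟯ →ₗ[ℝ] (M → ℝ) :=
    { toFun := fun f y => ξ (e.linearMapAt 𝕂 y ((defect D f X).1 y))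
      map_add' := fun f g => funext fun y => by
        rw [defect_add_left, add_apply, map_add, map_add]; rfl
      map_smul' := fun r f => funext fun y => by
        rw [defect_smul_left, smul_apply, hreal, map_smul]; rfl }
  have hd : ∀ f g q, d (f * g) q = f q * d g q + g q * d f q := fun f g q => by
    change ξ (e.linearMapAt 𝕂 q ((defect D (f * g) X).1 q)) = _
    rw [defect_mul D hlin, add_apply, map_add, map_add, fsmul_apply, fsmul_apply, hreal, hreal,
      map_smul, map_smul]
    rfl
  have hform : ∀ (f : C^(k : ℕ∞)⟮𝓘(ℝ, E), M; ℝ⟯), ∀ y ∈ e.baseSet,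
      d f y = ξ (e ⟨y, (defect D f X).1 y⟩).2 := fun f y hy => by
    change ξ (e.linearMapAt 𝕂 y _) = _
    rw [e.coe_linearMapAt_of_mem hy]
  have hsm : ∀ f, ContMDiffAt 𝓘(ℝ, E) 𝓘(ℝ, ℝ) (k : ℕ∞) (d f) x := fun f => by
    have hξ : ContDiff ℝ (k : ℕ∞) ξ := (LinearMap.toContinuousLinearMap ξ).contDiff
    refine (hξ.contMDiff.contMDiffAt.comp x
      (contMDiffAt_localForm (defect D f X) hb hx)).congr_of_eventuallyEq ?_
    filter_upwards [e.open_baseSet.mem_nhds hx] with y hy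
    exact hform f y hy
  have h := leibniz_eq_zero hd hsm f
  rwa [hform f x hx] at h

/-- A derivation which is linear over functions is given pointwise. -/
theorem derivation_apply_eq_zero
    (D : LieDerivation 𝕂 (sections 𝕂 𝔨 E F L k) (sections 𝕂 𝔨 E F L k))
    (hlin : ∀ (f : C^k⟮𝓘(ℝ, E), M; ℝ⟯) (X : sections 𝕂 𝔨 E F L k), D (fsmul f X) = fsmul f (D X))
    (X : sections 𝕂 𝔨 E F L k) {x : M} (hX : X.1 x = 0) : (D X).1 x = 0 := by
  obtain ⟨e, hx, he⟩ := IsLieAlgebraBundle.exists_isLieChart (𝕂 := 𝕂) (𝔨 := 𝔨) (E := E)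
    (F := F) (L := L) x
  have hb := he.toIsBundleChart
  have hfd : FiniteDimensional ℝ F := FiniteDimensional.trans ℝ 𝕂 F
  let b := Module.finBasis ℝ F
  obtain ⟨χ, h1, hs⟩ := exists_contMDiff_bump (E := E) k (e.open_baseSet.mem_nhds hx)
  let f : Fin (Module.finrank ℝ F) → C^k⟮𝓘(ℝ, E), M; ℝ⟯ := fun i =>
    ⟨fun y => χ y * b.coord i (e ⟨y, X.1 y⟩).2, by
      refine contMDiff_of_tsupport (f := fun y => χ y * b.coord i (e ⟨y, X.1 y⟩).2) fun y hy => ?_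
      have hy' : y ∈ e.baseSet := hs (tsupport_mul_subset_left hy)
      have hξ : ContDiff ℝ k (b.coord i) := (LinearMap.toContinuousLinearMap (b.coord i)).contDiff
      exact χ.contMDiff.contMDiffAt.mul
        (hξ.contMDiff.contMDiffAt.comp y (contMDiffAt_localForm X hb hy'))⟩
  let B : Fin (Module.finrank ℝ F) → sections 𝕂 𝔨 E F L k := fun i =>
    cutoffSection hb χ hs (fun _ => b i) contMDiffOn_const
  -- One factor `χ` globalises the coefficients of `X`, the other globalises the frame.
  have hsum : fsmul (χ * χ) X = ∑ i, fsmul (f i) (B i) := by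
    refine sections_ext fun y => ?_
    rw [sum_apply]
    simp only [fsmul_apply]
    by_cases hy : y ∈ e.baseSet
    · apply (hb.fibreEquiv hy).injective
      rw [map_sum, hb.fibreEquiv_ofReal_smul]
      simp only [hb.fibreEquiv_ofReal_smul]
      have h2 : ∀ i, hb.fibreEquiv hy ((B i).1 y) = χ y • b i := fun i =>
        cutoffSection_apply hb χ hs _ _ hy
      simp only [h2]
      have h3 : ∀ i, f i y = χ y * b.coord i (hb.fibreEquiv hy (X.1 y)) := fun i => rfl
      simp only [h3, smul_smul]
      conv_lhs => rw [← b.sum_repr (hb.fibreEquiv hy (X.1 y)), Finset.smul_sum]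
      refine Finset.sum_congr rfl fun i _ => ?_
      rw [smul_smul]
      congr 1
      change χ y * χ y * _ = _
      rw [Module.Basis.coord_apply]; ring
    · have hχ : χ y = 0 := image_eq_zero_of_notMem_tsupport fun h => hy (hs h)
      have h2 : (χ * χ) y = 0 := by change χ y * χ y = 0; simp [hχ]
      have h3 : ∀ i, f i y = 0 := fun i => by change χ y * _ = 0; simp [hχ]
      simp [h2, h3]
  have h2 := congrArg (fun Z => (D Z).1 x) hsum
  simp only [map_sum, hlin, sum_apply, fsmul_apply] at h2
  have h3 : (χ * χ) x = 1 := by change χ x * χ x = 1; simp [h1.eq_of_nhds]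
  have h4 : ∀ i, f i x = 0 := fun i => by
    have h5 : (e ⟨x, X.1 x⟩).2 = 0 := by
      rw [hX, ← hb.fibreEquiv_apply hx, map_zero]
    change χ x * b.coord i (e ⟨x, X.1 x⟩).2 = 0
    rw [h5, map_zero, mul_zero]
  simpa [h3, h4] using h2

end Sections

/-! ### Derivations of order zero and sections of `Der(L)`. -/

section Pointwise

variable {𝕂 : Type*} [RCLike 𝕂] {𝔨 : Type*} [LieRing 𝔨] [LieAlgebra 𝕂 𝔨]
  {E : Type*} [NormedAddCommGroup E] [NormedSpace ℝ E] [FiniteDimensional ℝ E]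
  {M : Type*} [TopologicalSpace M] [ChartedSpace E M] [IsManifold 𝓘(ℝ, E) ∞ M] [T2Space M]
  {F : Type*} [NormedAddCommGroup F] [NormedSpace ℝ F] [NormedSpace 𝕂 F]
  [IsScalarTower ℝ 𝕂 F] [FiniteDimensional 𝕂 F]
  {L : M → Type*} [∀ x, LieRing (L x)] [∀ x, LieAlgebra 𝕂 (L x)]
  [∀ x, TopologicalSpace (L x)] [TopologicalSpace (TotalSpace F L)] [FiberBundle F L]
  [IsLieAlgebraBundle 𝕂 𝔨 E F L] {k : ℕ∞}

omit [FiniteDimensional ℝ E] [IsManifold 𝓘(ℝ, E) ∞ M] [T2Space M] [IsScalarTower ℝ 𝕂 F]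
  [IsLieAlgebraBundle 𝕂 𝔨 E F L] in
theorem localForm_apply_fibre {e : Trivialization F (π F L)} (he : IsBundleChart 𝕂 E e)
    (Δ : ∀ x, L x →ₗ[𝕂] L x) {y : M} (hy : y ∈ e.baseSet) (v : L y) :
    localForm 𝕂 e he.isLinear Δ y (e ⟨y, v⟩).2 = (e ⟨y, Δ y v⟩).2 := by
  have := he.isLinear
  have h : ∀ w : L y, e.linearMapAt 𝕂 y w = (e ⟨y, w⟩).2 := fun w => by
    rw [e.coe_linearMapAt_of_mem hy]
  simp only [localForm, LinearMap.coe_toContinuousLinearMap', LinearMap.comp_apply]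
  rw [← h v, e.symmₗ_linearMapAt hy, h]

/-- The derivation of sections given by a section of `Der(L)`. -/
noncomputable def derivationOfSection (Δ : derSections 𝕂 𝔨 E F L k) :
    LieDerivation 𝕂 (sections 𝕂 𝔨 E F L k) (sections 𝕂 𝔨 E F L k) where
  toFun X := ⟨fun y => Δ.1 y (X.1 y), by
    rw [mem_sections_iff]
    intro x
    obtain ⟨e, hx, he⟩ := IsLieAlgebraBundle.exists_isLieChart (𝕂 := 𝕂) (𝔨 := 𝔨) (E := E)
      (F := F) (L := L) x
    have hb := he.toIsBundleChart
    have h1 := (Δ.2 e he).contMDiffAt (e.open_baseSet.mem_nhds hx)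
    have hm : ContDiff ℝ k (fun p : (F →L[𝕂] F) × F => p.1 p.2) :=
      ((ContinuousLinearMap.id 𝕂 (F →L[𝕂] F)).bilinearRestrictScalars ℝ).isBoundedBilinearMap.contDiff
    refine ⟨e, hx, hb, (hm.contMDiff.contMDiffAt.comp x
      (h1.prodMk_space (contMDiffAt_localForm X hb hx))).congr_of_eventuallyEq ?_⟩
    filter_upwards [e.open_baseSet.mem_nhds hx] with y hy
    exact (localForm_apply_fibre hb (fun x => (Δ.1 x : L x →ₗ[𝕂] L x)) hy (X.1 y)).symm⟩
  map_add' X Y := sections_ext fun y => map_add (Δ.1 y) _ _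
  map_smul' c X := sections_ext fun y => map_smul (Δ.1 y) _ _
  leibniz' X Y := sections_ext fun y => LieDerivation.apply_lie_eq_sub (Δ.1 y) (X.1 y) (Y.1 y)

omit [FiniteDimensional ℝ E] [IsManifold 𝓘(ℝ, E) ∞ M] [T2Space M] in
theorem derivationOfSection_apply (Δ : derSections 𝕂 𝔨 E F L k) (X : sections 𝕂 𝔨 E F L k) (y : M) :
    (derivationOfSection Δ X).1 y = Δ.1 y (X.1 y) := rfl

variable (hpt : ∀ (D : LieDerivation 𝕂 (sections 𝕂 𝔨 E F L k) (sections 𝕂 𝔨 E F L k))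
  (X : sections 𝕂 𝔨 E F L k) (x : M), X.1 x = 0 → (D X).1 x = 0)

section

variable (D : LieDerivation 𝕂 (sections 𝕂 𝔨 E F L k) (sections 𝕂 𝔨 E F L k))

/-- The value at a point of a derivation of order zero, as a map of the fibre. -/
noncomputable def fibreMap (x : M) (v : L x) : L x :=
  (D (exists_section_apply_eq 𝕂 𝔨 E F k x v).choose).1 x

include hpt in
-- Independence of the chosen extension: two sections with the same value at `x` differ by one that
-- vanishes there.
theorem fibreMap_apply (x : M) (X : sections 𝕂 𝔨 E F L k) :
    fibreMap D x (X.1 x) = (D X).1 x := by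
  have h := hpt D ((exists_section_apply_eq 𝕂 𝔨 E F k x (X.1 x)).choose - X) x (by
    rw [sub_apply, (exists_section_apply_eq 𝕂 𝔨 E F k x (X.1 x)).choose_spec, sub_self])
  rw [map_sub, sub_apply, sub_eq_zero] at h
  exact h

/-- The value at a point of a derivation of order zero, as a derivation of the fibre. -/
noncomputable def fibreDerivation (x : M) : LieDerivation 𝕂 (L x) (L x) where
  toFun := fibreMap D x
  map_add' v w := by
    obtain ⟨X, rfl⟩ := exists_section_apply_eq 𝕂 𝔨 E F k x v
    obtain ⟨Y, rfl⟩ := exists_section_apply_eq 𝕂 𝔨 E F k x w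
    rw [← add_apply, fibreMap_apply hpt, fibreMap_apply hpt, fibreMap_apply hpt, map_add, add_apply]
  map_smul' c v := by
    obtain ⟨X, rfl⟩ := exists_section_apply_eq 𝕂 𝔨 E F k x v
    rw [← smul_apply, fibreMap_apply hpt, fibreMap_apply hpt, map_smul, smul_apply]; rfl
  leibniz' v w := by
    obtain ⟨X, rfl⟩ := exists_section_apply_eq 𝕂 𝔨 E F k x v
    obtain ⟨Y, rfl⟩ := exists_section_apply_eq 𝕂 𝔨 E F k x w
    change fibreMap D x ⁅X.1 x, Y.1 x⁆ =
      ⁅X.1 x, fibreMap D x (Y.1 x)⁆ - ⁅Y.1 x, fibreMap D x (X.1 x)⁆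
    rw [← lie_apply, fibreMap_apply hpt, fibreMap_apply hpt, fibreMap_apply hpt,
      LieDerivation.apply_lie_eq_sub, sub_apply, lie_apply, lie_apply]

theorem fibreDerivation_apply (x : M) (X : sections 𝕂 𝔨 E F L k) :
    fibreDerivation hpt D x (X.1 x) = (D X).1 x := fibreMap_apply hpt D x X

/-- Extend a basis of `F` to sections `X i` that are constant in the chart near `x`. The columns of
the local form are then the local forms of `D (X i)`, which are `C^k`. -/
theorem fibreDerivation_mem : fibreDerivation hpt D ∈ derSections 𝕂 𝔨 E F L k := by
  intro e he x hx
  have hb := he.toIsBundleChart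
  refine ContMDiffAt.contMDiffWithinAt ?_
  let b := Module.finBasis 𝕂 F
  choose X hX using fun i => exists_section_eventually_eq 𝔨 k hb hx (b i)
  let S : Fin (Module.finrank 𝕂 F) → F →L[𝕂] F →L[𝕂] F := fun i =>
    ContinuousLinearMap.smulRightL 𝕂 F F (LinearMap.toContinuousLinearMap (b.coord i))
  have h1 : ∀ i, ContMDiffAt 𝓘(ℝ, E) 𝓘(ℝ, F →L[𝕂] F) k
      (fun y => S i (e ⟨y, (D (X i)).1 y⟩).2) x := fun i => by
    have hS : ContDiff ℝ k (S i) := ((S i).restrictScalars ℝ).contDiff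
    exact hS.contMDiff.contMDiffAt.comp x (contMDiffAt_localForm (D (X i)) hb hx)
  have h2 : ContMDiffAt 𝓘(ℝ, E) 𝓘(ℝ, F →L[𝕂] F) k
      (fun y => ∑ i, S i (e ⟨y, (D (X i)).1 y⟩).2) x :=
    contMDiffAt_finsetSum fun i _ => h1 i
  refine h2.congr_of_eventuallyEq ?_
  filter_upwards [e.open_baseSet.mem_nhds hx, eventually_all.2 hX] with y hy hXy
  refine ContinuousLinearMap.coe_injective (b.ext fun j => ?_)
  have h3 : ∀ i, (S i (e ⟨y, (D (X i)).1 y⟩).2) (b j) =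
      b.coord i (b j) • (e ⟨y, (D (X i)).1 y⟩).2 := fun i => rfl
  simp only [ContinuousLinearMap.coe_coe, _root_.sum_apply, h3]
  rw [Finset.sum_eq_single j]
  · rw [← fibreDerivation_apply hpt, ← hXy j]
    have h4 := localForm_apply_fibre hb
      (fun x => (fibreDerivation hpt D x : L x →ₗ[𝕂] L x)) hy ((X j).1 y)
    rw [h4, hXy j]
    simp
  · intro i _ hij
    simp [Finsupp.single_eq_of_ne hij]
  · simp

end

/-- If all derivations of the Lie algebra of sections have order zero, they form the Lie algebra of
sections of `Der(L)`. -/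
noncomputable def derivationEquiv :
    LieDerivation 𝕂 (sections 𝕂 𝔨 E F L k) (sections 𝕂 𝔨 E F L k) ≃ₗ⁅𝕂⁆
      derSections 𝕂 𝔨 E F L k where
  toFun D := ⟨fibreDerivation hpt D, fibreDerivation_mem hpt D⟩
  map_add' D D' := by
    refine Subtype.ext (funext fun x => LieDerivation.ext fun v => ?_)
    obtain ⟨X, rfl⟩ := exists_section_apply_eq 𝕂 𝔨 E F k x v
    change fibreDerivation hpt (D + D') x (X.1 x) =
      fibreDerivation hpt D x (X.1 x) + fibreDerivation hpt D' x (X.1 x)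
    simp only [fibreDerivation_apply]
    rfl
  map_smul' c D := by
    refine Subtype.ext (funext fun x => LieDerivation.ext fun v => ?_)
    obtain ⟨X, rfl⟩ := exists_section_apply_eq 𝕂 𝔨 E F k x v
    change fibreDerivation hpt (c • D) x (X.1 x) = c • fibreDerivation hpt D x (X.1 x)
    simp only [fibreDerivation_apply]
    rfl
  map_lie' {D D'} := by
    refine Subtype.ext (funext fun x => LieDerivation.ext fun v => ?_)
    obtain ⟨X, rfl⟩ := exists_section_apply_eq 𝕂 𝔨 E F k x v
    change fibreDerivation hpt ⁅D, D'⁆ x (X.1 x) =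
      ⁅fibreDerivation hpt D x, fibreDerivation hpt D' x⁆ (X.1 x)
    rw [LieDerivation.lie_apply]
    simp only [fibreDerivation_apply]
    rw [LieDerivation.lie_apply, sub_apply]
  invFun := derivationOfSection
  left_inv D := by
    refine LieDerivation.ext fun X => sections_ext fun y => ?_
    rw [derivationOfSection_apply]
    exact fibreDerivation_apply hpt D y X
  right_inv Δ := by
    refine Subtype.ext (funext fun x => LieDerivation.ext fun v => ?_)
    obtain ⟨X, rfl⟩ := exists_section_apply_eq 𝕂 𝔨 E F k x v
    exact fibreDerivation_apply hpt (derivationOfSection Δ) x X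

theorem derivationEquiv_apply
    (D : LieDerivation 𝕂 (sections 𝕂 𝔨 E F L k) (sections 𝕂 𝔨 E F L k))
    (X : sections 𝕂 𝔨 E F L k) (x : M) :
    (derivationEquiv hpt D).1 x (X.1 x) = (D X).1 x := fibreDerivation_apply hpt D x X

include hpt in
theorem isDiffOpOrderZero_of_pointwise
    (D : LieDerivation 𝕂 (sections 𝕂 𝔨 E F L k) (sections 𝕂 𝔨 E F L k)) :
    IsDiffOpOrderZero D.toLinearMap := by
  intro x
  obtain ⟨e, hx, he⟩ := IsLieAlgebraBundle.exists_isLieChart (𝕂 := 𝕂) (𝔨 := 𝔨) (E := E)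
    (F := F) (L := L) x
  refine ⟨e, hx, he.toIsBundleChart, _, fibreDerivation_mem hpt D e he, fun X y hy => ?_⟩
  rw [localForm_apply_fibre he.toIsBundleChart _ hy]
  change _ = (e ⟨y, fibreDerivation hpt D y (X.1 y)⟩).2
  rw [fibreDerivation_apply]
  rfl

end Pointwise

end LieAlgebraBundle

/-! ### Spanning families in a vector space: smooth coefficients and genericity. -/

section Span

variable {ι : Type*} [Fintype ι] {E F : Type*} [NormedAddCommGroup F] [NormedSpace ℝ F]
  [FiniteDimensional ℝ F]

/-- Coefficients with respect to a spanning family can be chosen to depend smoothly on the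
family. -/
theorem exists_contDiffAt_coefficients {z₀ : ι → F} (hz : Submodule.span ℝ (range z₀) = ⊤) :
    ∃ g : (ι → F) → F →L[ℝ] (ι → ℝ), ContDiffAt ℝ ∞ g z₀ ∧
      ∀ᶠ z in 𝓝 z₀, ∀ v, ∑ i, g z v i • z i = v := by
  let T : (ι → F) →L[ℝ] (ι → ℝ) →L[ℝ] F := ∑ i, (ContinuousLinearMap.smulRightL ℝ (ι → ℝ) F
    (ContinuousLinearMap.proj i)).comp (ContinuousLinearMap.proj i)
  have hT : ∀ z t, T z t = ∑ i, t i • z i := fun z t => by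
    simp [T, _root_.sum_apply]
  have hsurj : LinearMap.range (T z₀ : (ι → ℝ) →ₗ[ℝ] F) = ⊤ := by
    rw [eq_top_iff, ← hz, Submodule.span_le]
    rintro _ ⟨i, rfl⟩
    classical
    exact ⟨Pi.single i 1, by simp [hT, Pi.single_apply]⟩
  obtain ⟨S₀, hS₀⟩ := (T z₀ : (ι → ℝ) →ₗ[ℝ] F).exists_rightInverse_of_surjective hsurj
  let S : F →L[ℝ] (ι → ℝ) := LinearMap.toContinuousLinearMap S₀
  have hTS : (T z₀).comp S = 1 := by
    ext v
    exact LinearMap.congr_fun hS₀ v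
  -- A fixed right inverse `S` of `T z₀` makes `T z ∘ S` the identity at `z₀`, hence invertible
  -- nearby; the coefficients are `S ∘ (T z ∘ S)⁻¹`, and inversion is smooth.
  let P : (ι → F) →L[ℝ] F →L[ℝ] F := ((ContinuousLinearMap.compL ℝ F (ι → ℝ) F).flip S).comp T
  have hP : ∀ z, P z = (T z).comp S := fun z => rfl
  have : CompleteSpace F := FiniteDimensional.complete ℝ F
  have hPz : P z₀ = ((1 : (F →L[ℝ] F)ˣ) : F →L[ℝ] F) := by rw [hP, hTS, Units.val_one]
  refine ⟨fun z => S.comp (Ring.inverse (P z)), ?_, ?_⟩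
  · have h1 : ContDiffAt ℝ ∞ Ring.inverse (P z₀) := by
      rw [hPz]; exact contDiffAt_ringInverse ℝ 1
    exact (ContinuousLinearMap.compL ℝ F F (ι → ℝ) S).contDiff.contDiffAt.comp z₀
      (h1.comp z₀ P.contDiff.contDiffAt)
  · have h2 : ∀ᶠ z in 𝓝 z₀, IsUnit (P z) :=
      P.continuous.continuousAt.eventually (Units.isOpen.mem_nhds (hPz ▸ Units.isUnit 1))
    filter_upwards [h2] with z hz v
    rw [← hT]
    change ((T z).comp S) (Ring.inverse (P z) v) = v
    rw [← hP, ← mul_apply_eq_comp, Ring.mul_inverse_cancel _ hz]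
    rfl

omit [FiniteDimensional ℝ F] in
theorem span_range_eq_top_of_forall {z : ι → F} (h : ∀ v, ∃ t : ι → ℝ, ∑ i, t i • z i = v) :
    Submodule.span ℝ (range z) = ⊤ := by
  rw [eq_top_iff]
  intro v _
  obtain ⟨t, rfl⟩ := h v
  exact Submodule.sum_mem _ fun i _ =>
    Submodule.smul_mem _ _ (Submodule.subset_span (mem_range_self i))

theorem isOpen_setOf_span_range_eq_top : IsOpen {z : ι → F | Submodule.span ℝ (range z) = ⊤} := by
  rw [isOpen_iff_mem_nhds]
  intro z₀ hz₀
  obtain ⟨g, -, hg⟩ := exists_contDiffAt_coefficients hz₀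
  filter_upwards [hg] with z hz
  exact span_range_eq_top_of_forall fun v => ⟨_, hz v⟩

variable [NormedAddCommGroup E] [NormedSpace ℝ E] [FiniteDimensional ℝ E]

/-- A generic translate of a family of sufficiently many `C^1`-maps spans at every point. -/
theorem dense_setOf_translate_spans [Nontrivial F] {s : Set E} (hs : Convex ℝ s)
    {y : E → ι → F} (hy : ContDiffOn ℝ 1 y s)
    (hι : Module.finrank ℝ E + Module.finrank ℝ F * Module.finrank ℝ F < Fintype.card ι) :
    Dense {c : ι → F | ∀ x ∈ s, Submodule.span ℝ (range (y x + c)) = ⊤} := by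
  obtain ⟨m, hm⟩ : ∃ m, Module.finrank ℝ F = m + 1 :=
    Nat.exists_eq_succ_of_ne_zero Module.finrank_pos.ne'
  let V := E × (Fin m → F) × (ι → Fin m → ℝ)
  -- If `y x + c` fails to span, it lies in a hyperplane. With `m` spanning vectors `b j` of the
  -- hyperplane and coefficients `a i j`, one gets `c i = ∑ a i j • b j - y x i`; so the bad
  -- translates lie in the image of `G`.
  let G : V → ι → F := fun p i => ∑ j, p.2.2 i j • p.2.1 j - y p.1 i
  have hG : ContDiffOn ℝ 1 G (s ×ˢ univ) := by
    rw [contDiffOn_pi]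
    intro i
    have h1 : ContDiff ℝ 1 fun p : V => ∑ j, p.2.2 i j • p.2.1 j := by fun_prop
    have h2 : ContDiffOn ℝ 1 (fun p : V => y p.1) (s ×ˢ univ) :=
      hy.comp contDiff_fst.contDiffOn fun p hp => hp.1
    exact h1.contDiffOn.sub (contDiffOn_pi.1 h2 i)
  -- With `n = dim E` and `N = card ι`, this is `n + m(m+1) + Nm < N(m+1)`, that is `n + m(m+1) <
  -- N`. A `C^1`-image from a smaller dimension has dense complement.
  have hdim : Module.finrank ℝ V < Module.finrank ℝ (ι → F) := by
    simp only [V, Module.finrank_prod, Module.finrank_pi_fintype, Finset.sum_const,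
      Finset.card_univ, Fintype.card_fin, smul_eq_mul, Module.finrank_self, hm] at hι ⊢
    nlinarith
  have hdense : Dense (G '' (s ×ˢ univ))ᶜ :=
    hG.dense_compl_image_of_dimH_lt_finrank (hs.prod convex_univ) subset_rfl
      ((dimH_mono (subset_univ _)).trans_lt
        (by rw [Real.dimH_univ_eq_finrank]; exact_mod_cast hdim))
  refine hdense.mono fun c hc x hx => ?_
  by_contra hne
  obtain ⟨ξ, hξ, hle⟩ := Submodule.exists_le_ker_of_lt_top _ (lt_top_iff_ne_top.2 hne)
  have hker : Module.finrank ℝ (LinearMap.ker ξ) = m := by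
    have := Module.Dual.finrank_ker_add_one_of_ne_zero hξ
    omega
  let b := Module.finBasisOfFinrankEq ℝ (LinearMap.ker ξ) hker
  have hmem : ∀ i, y x i + c i ∈ LinearMap.ker ξ := fun i =>
    hle (Submodule.subset_span ⟨i, rfl⟩)
  refine hc ⟨(x, fun j => (b j : F), fun i j => b.repr ⟨_, hmem i⟩ j), ⟨hx, mem_univ _⟩, ?_⟩
  ext i
  have h1 := congrArg Subtype.val (b.sum_repr ⟨_, hmem i⟩)
  simp only [Submodule.coe_sum, Submodule.coe_smul] at h1
  simp only [G]
  rw [h1, add_sub_cancel_left]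

end Span

/-! ### Real spanning families and the algebraic hypotheses on fibres. -/

namespace LieAlgebraBundle

/-- Every vector is a real linear combination of the given family. -/
def RealSpans (𝕂 : Type*) [RCLike 𝕂] {ι V : Type*} [Fintype ι] [AddCommGroup V] [Module 𝕂 V]
    (z : ι → V) : Prop := ∀ v, ∃ t : ι → ℝ, ∑ i, (t i : 𝕂) • z i = v

section

variable {𝕂 : Type*} [RCLike 𝕂] {ι V W : Type*} [Fintype ι] [AddCommGroup V] [Module 𝕂 V]
  [AddCommGroup W] [Module 𝕂 W]

theorem realSpans_comp_iff {z : ι → V} (φ : V ≃ₗ[𝕂] W) :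
    RealSpans 𝕂 (fun i => φ (z i)) ↔ RealSpans 𝕂 z := by
  constructor
  · intro h v
    obtain ⟨t, ht⟩ := h (φ v)
    exact ⟨t, φ.injective (by simpa using ht)⟩
  · intro h w
    obtain ⟨t, ht⟩ := h (φ.symm w)
    exact ⟨t, by rw [← φ.apply_symm_apply w, ← ht]; simp⟩

theorem realSpans_iff_span_eq_top {F : Type*} [NormedAddCommGroup F] [NormedSpace ℝ F]
    [NormedSpace 𝕂 F] [IsScalarTower ℝ 𝕂 F] {z : ι → F} :
    RealSpans 𝕂 z ↔ Submodule.span ℝ (range z) = ⊤ := by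
  constructor
  · intro h
    refine span_range_eq_top_of_forall fun v => ?_
    obtain ⟨t, ht⟩ := h v
    exact ⟨t, by simpa only [RCLike.real_smul_eq_coe_smul (K := 𝕂)] using ht⟩
  · intro h v
    obtain ⟨t, ht⟩ := (Submodule.mem_span_range_iff_exists_fun ℝ).1 (h ▸ Submodule.mem_top (x := v))
    exact ⟨t, by simpa only [RCLike.real_smul_eq_coe_smul (K := 𝕂)] using ht⟩

/-- In a perfect Lie algebra, the brackets of a spanning family span. -/
theorem RealSpans.lie {V : Type*} [LieRing V] [LieAlgebra 𝕂 V] {z : ι → V} (hz : RealSpans 𝕂 z)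
    (hV : Submodule.span 𝕂 {v : V | ∃ a b : V, ⁅a, b⁆ = v} = ⊤) :
    RealSpans 𝕂 (fun p : ι × ι => ⁅z p.1, z p.2⁆) := by
  have hlie : ∀ a b : V, ∃ t : ι × ι → ℝ, ∑ p, (t p : 𝕂) • ⁅z p.1, z p.2⁆ = ⁅a, b⁆ := fun a b => by
    obtain ⟨t, rfl⟩ := hz a
    obtain ⟨s, rfl⟩ := hz b
    refine ⟨fun p => t p.1 * s p.2, ?_⟩
    rw [sum_lie, Fintype.sum_prod_type]
    refine Finset.sum_congr rfl fun i _ => ?_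
    rw [lie_sum]
    refine Finset.sum_congr rfl fun j _ => ?_
    rw [smul_lie, lie_smul, RCLike.ofReal_mul, mul_smul]
  intro v
  have hv : v ∈ Submodule.span 𝕂 {v : V | ∃ a b : V, ⁅a, b⁆ = v} := hV ▸ Submodule.mem_top
  induction hv using Submodule.closure_induction with
  | zero => exact ⟨0, by simp⟩
  | add v w _ _ hv hw =>
    obtain ⟨t, rfl⟩ := hv
    obtain ⟨s, rfl⟩ := hw
    exact ⟨t + s, by simp [add_smul, Finset.sum_add_distrib]⟩
  -- A scalar from `𝕂` is absorbed into the left slot, so real coefficients still suffice.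
  | smul_mem c v hv =>
    obtain ⟨a, b, rfl⟩ := hv
    rw [← smul_lie]
    exact hlie _ _

theorem span_lie_eq_top {𝔨 : Type*} [LieRing 𝔨] [LieAlgebra 𝕂 𝔨] {V : Type*} [LieRing V]
    [LieAlgebra 𝕂 V] (φ : V ≃ₗ⁅𝕂⁆ 𝔨) (h : ⁅(⊤ : LieIdeal 𝕂 𝔨), (⊤ : LieIdeal 𝕂 𝔨)⁆ = ⊤) :
    Submodule.span 𝕂 {v : V | ∃ a b : V, ⁅a, b⁆ = v} = ⊤ := by
  have h1 : (⁅(⊤ : LieIdeal 𝕂 𝔨), (⊤ : LieIdeal 𝕂 𝔨)⁆ : LieIdeal 𝕂 𝔨).toSubmodule =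
    (⊤ : LieIdeal 𝕂 𝔨).toSubmodule := by rw [h]
  rw [LieSubmodule.lieIdeal_oper_eq_linear_span'] at h1
  rw [eq_top_iff]
  intro v _
  have h2 : φ v ∈ (⊤ : LieIdeal 𝕂 𝔨).toSubmodule := Submodule.mem_top
  rw [← h1] at h2
  have h4 := Submodule.mem_map_of_mem (f := (φ.symm : 𝔨 ≃ₗ[𝕂] V).toLinearMap) h2
  rw [Submodule.map_span] at h4
  have h5 : (φ.symm : 𝔨 ≃ₗ[𝕂] V).toLinearMap (φ v) = v := φ.symm_apply_apply v
  rw [h5] at h4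
  refine Submodule.span_mono ?_ h4
  rintro _ ⟨_, ⟨a, -, b, -, rfl⟩, rfl⟩
  exact ⟨φ.symm a, φ.symm b, (LieEquiv.map_lie φ.symm a b).symm⟩

theorem eq_zero_of_center_eq_bot {𝔨 : Type*} [LieRing 𝔨] [LieAlgebra 𝕂 𝔨] {V : Type*} [LieRing V]
    [LieAlgebra 𝕂 V] (φ : V ≃ₗ⁅𝕂⁆ 𝔨) (h : LieAlgebra.center 𝕂 𝔨 = ⊥) (v : V)
    (hv : ∀ w : V, ⁅v, w⁆ = 0) : v = 0 := by
  have h1 : φ v ∈ LieAlgebra.center 𝕂 𝔨 := by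
    rw [LieModule.mem_maxTrivSubmodule]
    intro w
    rw [← φ.apply_symm_apply w, ← LieEquiv.map_lie, ← lie_skew, hv, neg_zero, map_zero]
  rw [h, LieSubmodule.mem_bot] at h1
  exact φ.injective (h1.trans (map_zero φ).symm)

end

/-- A smooth bump function as a bundled smooth map. -/
noncomputable def bumpMap {E : Type*} [NormedAddCommGroup E] [NormedSpace ℝ E]
    [FiniteDimensional ℝ E] {M : Type*} [TopologicalSpace M] [ChartedSpace E M]
    [IsManifold 𝓘(ℝ, E) ∞ M] [T2Space M] {p : M} (f : SmoothBumpFunction 𝓘(ℝ, E) p) :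
    C^∞⟮𝓘(ℝ, E), M; ℝ⟯ := ⟨f, f.contMDiff⟩

/-! ### Finitely many sections spanning all fibres, and perfectness of the algebra of sections. -/

section Generic

variable {𝕂 : Type*} [RCLike 𝕂] {𝔨 : Type*} [LieRing 𝔨] [LieAlgebra 𝕂 𝔨]
  {E : Type*} [NormedAddCommGroup E] [NormedSpace ℝ E] [FiniteDimensional ℝ E]
  {M : Type*} [TopologicalSpace M] [ChartedSpace E M] [IsManifold 𝓘(ℝ, E) ∞ M] [T2Space M]
  {F : Type*} [NormedAddCommGroup F] [NormedSpace ℝ F] [NormedSpace 𝕂 F]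
  [IsScalarTower ℝ 𝕂 F] [FiniteDimensional 𝕂 F]
  {L : M → Type*} [∀ x, LieRing (L x)] [∀ x, LieAlgebra 𝕂 (L x)]
  [∀ x, TopologicalSpace (L x)] [TopologicalSpace (TotalSpace F L)] [FiberBundle F L]
  [IsLieAlgebraBundle 𝕂 𝔨 E F L] {ι : Type*} [Fintype ι]

omit [FiniteDimensional ℝ E] [IsManifold 𝓘(ℝ, E) ∞ M] [T2Space M] [FiniteDimensional 𝕂 F]
  [IsLieAlgebraBundle 𝕂 𝔨 E F L] in
theorem IsBundleChart.realSpans_iff {e : Trivialization F (π F L)} (he : IsBundleChart 𝕂 E e)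
    {x : M} (hx : x ∈ e.baseSet) (z : ι → L x) :
    RealSpans 𝕂 z ↔ Submodule.span ℝ (range fun i => (e ⟨x, z i⟩).2) = ⊤ := by
  rw [← realSpans_comp_iff (he.fibreEquiv hx), realSpans_iff_span_eq_top]
  rfl

/-- A finite family of sections, modified by constants in a chart. -/
noncomputable def perturb {e : Trivialization F (π F L)} (he : IsBundleChart 𝕂 E e)
    (χ : C^∞⟮𝓘(ℝ, E), M; ℝ⟯) (hχ : tsupport χ ⊆ e.baseSet) (Y : ι → sections 𝕂 𝔨 E F L ⊤)
    (c : ι → F) (i : ι) : sections 𝕂 𝔨 E F L ⊤ :=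
  Y i + cutoffSection he χ hχ (fun _ => c i) contMDiffOn_const

section

variable {e : Trivialization F (π F L)} (he : IsBundleChart 𝕂 E e)
    (χ : C^∞⟮𝓘(ℝ, E), M; ℝ⟯) (hχ : tsupport χ ⊆ e.baseSet) (Y : ι → sections 𝕂 𝔨 E F L ⊤)

omit [FiniteDimensional ℝ E] [IsManifold 𝓘(ℝ, E) ∞ M] [T2Space M] [Fintype ι] in
theorem perturb_apply (c : ι → F) (i : ι) {y : M} (hy : y ∈ e.baseSet) :
    (e ⟨y, (perturb he χ hχ Y c i).1 y⟩).2 = (e ⟨y, (Y i).1 y⟩).2 + χ y • c i := by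
  rw [← cutoffSection_apply (𝔨 := 𝔨) he χ hχ (fun _ => c i) contMDiffOn_const hy]
  exact map_add (he.fibreEquiv hy) _ _

omit [FiniteDimensional ℝ E] [IsManifold 𝓘(ℝ, E) ∞ M] [T2Space M] [Fintype ι] in
theorem perturb_eq_of_eq_zero (c : ι → F) (i : ι) {y : M} (hy : χ y = 0) :
    (perturb he χ hχ Y c i).1 y = (Y i).1 y := by
  rw [perturb, add_apply, cutoffSection_eq_zero he χ hχ _ _ hy, add_zero]

omit [FiniteDimensional ℝ E] [IsManifold 𝓘(ℝ, E) ∞ M] [T2Space M] in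
-- Spanning is an open condition, jointly in the point and the perturbation, and `K` is compact.
-- Near points outside the chart domain the perturbation is zero.
theorem eventually_realSpans_perturb {K : Set M} (hK : IsCompact K)
    (hY : ∀ x ∈ K, RealSpans 𝕂 fun i => (Y i).1 x) :
    ∀ᶠ c in 𝓝 (0 : ι → F), ∀ x ∈ K, RealSpans 𝕂 fun i => (perturb he χ hχ Y c i).1 x := by
  have hfd : FiniteDimensional ℝ F := FiniteDimensional.trans ℝ 𝕂 F
  refine hK.eventually_forall_of_forall_eventually fun x hx => ?_
  have hcont : ∀ {e' : Trivialization F (π F L)}, IsBundleChart 𝕂 E e' → x ∈ e'.baseSet →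
      ContinuousAt (fun y => fun i => (e' ⟨y, (Y i).1 y⟩).2) x := fun he' hx' =>
    continuousAt_pi.2 fun i => (contMDiffAt_localForm (Y i) he' hx').continuousAt
  by_cases hxe : x ∈ e.baseSet
  · have h1 : ContinuousAt
        (fun p : (ι → F) × M => fun i => (e ⟨p.2, (Y i).1 p.2⟩).2 + χ p.2 • p.1 i) (0, x) := by
      have h2 : ContinuousAt (fun p : (ι → F) × M => fun i => (e ⟨p.2, (Y i).1 p.2⟩).2) (0, x) :=
        (hcont he hxe).tendsto.comp (continuousAt_snd (p := ((0 : ι → F), x)))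
      have h3 : Continuous fun p : (ι → F) × M => fun i => χ p.2 • p.1 i := by
        have := χ.contMDiff.continuous
        fun_prop
      exact h2.add h3.continuousAt
    have h4 := h1.eventually (isOpen_setOf_span_range_eq_top.mem_nhds (by
      simpa using (he.realSpans_iff hxe _).1 (hY x hx)))
    filter_upwards [h4, continuousAt_snd.eventually (e.open_baseSet.mem_nhds hxe)] with p hp hpe
    rw [he.realSpans_iff hpe]
    simp only [perturb_apply he χ hχ Y p.1 _ hpe]
    exact hp
  · obtain ⟨e', hx', he'⟩ := IsLieAlgebraBundle.exists_isLieChart (𝕂 := 𝕂) (𝔨 := 𝔨) (E := E)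
      (F := F) (L := L) x
    have hb := he'.toIsBundleChart
    have h1 := (hcont hb hx').eventually (isOpen_setOf_span_range_eq_top.mem_nhds
      ((hb.realSpans_iff hx' _).1 (hY x hx)))
    have h2 : ∀ᶠ y in 𝓝 x, y ∉ tsupport χ :=
      (isClosed_tsupport χ).isOpen_compl.mem_nhds fun h => hxe (hχ h)
    have h3 : ContinuousAt (Prod.snd : (ι → F) × M → M) (0, x) := continuousAt_snd
    filter_upwards [h3.eventually h1, h3.eventually h2,
      h3.eventually (e'.open_baseSet.mem_nhds hx')] with p hp1 hp2 hp3
    simp only [perturb_eq_of_eq_zero he χ hχ Y p.1 _ (image_eq_zero_of_notMem_tsupport hp2)]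
    exact (hb.realSpans_iff hp3 _).2 hp1

end

/-- Where the bump function equals `1` the perturbation is translation by `c` in the chart, and
these points lie in a coordinate ball, which is convex; so `dense_setOf_translate_spans` applies. -/
theorem dense_realSpans_perturb [Nontrivial F] {e : Trivialization F (π F L)}
    (he : IsBundleChart 𝕂 E e) {p : M} (f : SmoothBumpFunction 𝓘(ℝ, E) p)
    (hf : tsupport (bumpMap f) ⊆ e.baseSet) (Y : ι → sections 𝕂 𝔨 E F L ⊤)
    (hι : Module.finrank ℝ E + Module.finrank ℝ F * Module.finrank ℝ F < Fintype.card ι) :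
    Dense {c : ι → F | ∀ x, f x = 1 →
      RealSpans 𝕂 fun i => (perturb he (bumpMap f) hf Y c i).1 x} := by
  have hfd : FiniteDimensional ℝ F := FiniteDimensional.trans ℝ 𝕂 F
  set φ := extChartAt 𝓘(ℝ, E) p with hφ
  set s := Metric.ball (φ p) f.rOut with hs
  have hst : s ⊆ φ.target := by
    have := f.ball_subset
    rwa [ModelWithCorners.range_eq_univ, inter_univ] at this
  have hse : ∀ t ∈ s, φ.symm t ∈ e.baseSet := fun t ht => by
    refine hf (subset_tsupport _ ?_)
    change φ.symm t ∈ Function.support f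
    rw [f.support_eq_symm_image]
    exact ⟨t, ⟨ht, by simp⟩, rfl⟩
  have hy : ContDiffOn ℝ 1 (fun t => fun i => (e ⟨φ.symm t, (Y i).1 (φ.symm t)⟩).2) s := by
    rw [contDiffOn_pi]
    intro i t ht
    have h1 : ContMDiffAt 𝓘(ℝ, E) 𝓘(ℝ, E) ∞ φ.symm t :=
      (contMDiffOn_extChartAt_symm p).contMDiffAt
        (Filter.mem_of_superset (Metric.isOpen_ball.mem_nhds ht) hst)
    have h2 := (contMDiffAt_localForm (Y i) he (hse t ht)).comp t h1
    exact (h2.contDiffAt.of_le (by exact_mod_cast le_top)).contDiffWithinAt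
  refine (dense_setOf_translate_spans (convex_ball _ _) hy hι).mono fun c hc x hx => ?_
  have hxs : x ∈ Function.support f := by
    rw [Function.mem_support, hx]; exact one_ne_zero
  have hxe : x ∈ e.baseSet := hf (subset_tsupport _ hxs)
  rw [f.support_eq_inter_preimage] at hxs
  have h1 := hc (φ x) hxs.2
  rw [he.realSpans_iff hxe]
  simp only [perturb_apply he (bumpMap f) hf Y c _ hxe]
  have h2 : φ.symm (φ x) = x := φ.left_inv (by simpa [hφ] using hxs.1)
  rw [h2] at h1
  convert h1 using 4 with i
  change _ + f x • c i = _
  rw [hx, one_smul]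
  rfl

variable (𝕂 𝔨 E F L) in
/-- There are finitely many smooth sections which span all fibres. -/
theorem exists_sections_realSpans [SigmaCompactSpace M] : ∃ (N : ℕ)
    (Y : Fin N → sections 𝕂 𝔨 E F L ⊤), ∀ x, RealSpans 𝕂 fun i => (Y i).1 x := by
  rcases subsingleton_or_nontrivial F with hF | hF
  · refine ⟨0, fun _ => 0, fun x v => ⟨0, ?_⟩⟩
    obtain ⟨e, hx, he⟩ := IsLieAlgebraBundle.exists_isLieChart (𝕂 := 𝕂) (𝔨 := 𝔨) (E := E)
      (F := F) (L := L) x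
    exact (he.toIsBundleChart.fibreEquiv hx).injective (Subsingleton.elim _ _)
  obtain ⟨N, hN⟩ : ∃ N, Module.finrank ℝ E + Module.finrank ℝ F * Module.finrank ℝ F < N :=
    ⟨_, Nat.lt_succ_self _⟩
  refine ⟨N, ?_⟩
  choose e hxe he using fun x => IsLieAlgebraBundle.exists_isLieChart (𝕂 := 𝕂) (𝔨 := 𝔨) (E := E)
    (F := F) (L := L) x
  have hb := fun x => (he x).toIsBundleChart
  obtain ⟨κ, fs, hfs⟩ := SmoothBumpCovering.exists_isSubordinate 𝓘(ℝ, E) (isClosed_univ (X := M))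
    (U := fun x => (e x).baseSet) fun x _ => (e x).open_baseSet.mem_nhds (hxe x)
  have hne : ∀ j, (Function.support (fs j)).Nonempty := fun j => (fs j).nonempty_support
  have : Encodable κ := LocallyFinite.encodable fs.locallyFinite hne
  let Y₀ := Fin N → sections 𝕂 𝔨 E F L ⊤
  -- The number of sections stays fixed at `N`; the family is corrected successively over the
  -- countably many compact sets where a bump function is `1`.
  let good : ℕ → Y₀ → Prop := fun n Y => ∀ j, Encodable.encode j < n → ∀ x, fs j x = 1 →
    RealSpans 𝕂 fun i => (Y i).1 x
  have hK : ∀ j, IsCompact {x | fs j x = 1} := fun j =>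
    (fs j).hasCompactSupport.isCompact.of_isClosed_subset
      (isClosed_eq (fs j).continuous continuous_const) fun x (hx : fs j x = 1) =>
        subset_tsupport _ (by rw [Function.mem_support, hx]; exact one_ne_zero)
  have hstep : ∀ (n : ℕ) (Y : {Y : Y₀ // good n Y}), ∃ Y' : {Y : Y₀ // good (n + 1) Y},
      ∀ x, (∀ j, Encodable.encode j = n → fs j x = 0) → ∀ i, (Y'.1 i).1 x = (Y.1 i).1 x := by
    rintro n ⟨Y, hY⟩
    by_cases hn : ∃ j : κ, Encodable.encode j = n
    · obtain ⟨j, rfl⟩ := hn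
      have hfin : {l : κ | Encodable.encode l < Encodable.encode j}.Finite :=
        (finite_Iio (Encodable.encode j)).preimage Encodable.encode_injective.injOn
      have h1 : ∀ᶠ c in 𝓝 (0 : Fin N → F), ∀ l ∈ {l : κ | Encodable.encode l < Encodable.encode j},
          ∀ x ∈ {x | fs l x = 1}, RealSpans 𝕂 fun i =>
            (perturb (hb (fs.c j)) (bumpMap (fs j)) (hfs j) Y c i).1 x :=
        (eventually_all_finite hfin).2 fun l hl =>
          eventually_realSpans_perturb (hb (fs.c j)) _ (hfs j) Y (hK l) (hY l hl)
      -- Density yields spanning on the new compact set, smallness of `c` preserves it on the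
      -- finitely many earlier ones.
      obtain ⟨c, hc1, hc2⟩ := (dense_realSpans_perturb (hb (fs.c j)) (fs j) (hfs j) Y
        (by simpa using hN)).inter_nhds_nonempty h1
      refine ⟨⟨perturb (hb (fs.c j)) (bumpMap (fs j)) (hfs j) Y c, fun l hl => ?_⟩,
        fun x hx i => perturb_eq_of_eq_zero _ _ _ Y c i (hx j rfl)⟩
      rcases Nat.lt_succ_iff_lt_or_eq.1 hl with hl | hl
      · exact hc2 l hl
      · rw [Encodable.encode_injective hl]
        exact hc1
    · refine ⟨⟨Y, fun l hl => ?_⟩, fun _ _ _ => rfl⟩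
      rcases Nat.lt_succ_iff_lt_or_eq.1 hl with hl | hl
      · exact hY l hl
      · exact absurd ⟨l, hl⟩ hn
  choose next hnext using hstep
  let Y : ∀ n, {Y : Y₀ // good n Y} := fun n =>
    Nat.rec ⟨fun _ => 0, fun j hj => absurd hj (Nat.not_lt_zero _)⟩ (fun n Y => next n Y) n
  have hYs : ∀ n x, (∀ j, Encodable.encode j = n → fs j x = 0) →
      ∀ i, ((Y (n + 1)).1 i).1 x = ((Y n).1 i).1 x := fun n => hnext n (Y n)
  -- By local finiteness only finitely many bumps are nonzero near `x`, so the sequence is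
  -- eventually constant on a neighbourhood and the limit is a section.
  have hst : ∀ x, ∃ n, ∀ᶠ y in 𝓝 x, ∀ m ≥ n, ∀ i, ((Y m).1 i).1 y = ((Y n).1 i).1 y := by
    intro x
    obtain ⟨U, hU, hUf⟩ := fs.locallyFinite x
    obtain ⟨n, hn⟩ := (hUf.image Encodable.encode).bddAbove
    refine ⟨n + 1, ?_⟩
    filter_upwards [hU] with y hy m hm
    induction m, hm using Nat.le_induction with
    | base => exact fun _ => rfl
    | succ m hm ih =>
      intro i
      rw [← ih i]
      refine hYs m y (fun j hj => ?_) i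
      by_contra hne
      have := hn (mem_image_of_mem _ (show j ∈ {j | _} from ⟨y, hne, hy⟩))
      omega
  choose n hn using hst
  have hlim : ∀ x, ∀ᶠ y in 𝓝 x, ∀ i, ((Y (n y)).1 i).1 y = ((Y (n x)).1 i).1 y := fun x => by
    filter_upwards [hn x] with y hy i
    rw [← (hn y).self_of_nhds (max (n x) (n y)) (le_max_right _ _), hy _ (le_max_left _ _)]
  refine ⟨fun i => ⟨fun y => ((Y (n y)).1 i).1 y, mem_sections_of_eventuallyEq fun x =>
    ⟨(Y (n x)).1 i, (hlim x).mono fun y hy => hy i⟩⟩, fun x => ?_⟩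
  have h1 := fs.apply_ind x (mem_univ x)
  set j := fs.ind x (mem_univ x)
  have h2 := (Y (max (n x) (Encodable.encode j + 1))).2 j (lt_max_of_lt_right (Nat.lt_succ_self _))
    x h1
  have h3 := (hn x).self_of_nhds _ (le_max_left (n x) (Encodable.encode j + 1))
  simp only [h3] at h2
  exact h2

/-- If finitely many sections span all fibres, then every section is a combination of them. -/
theorem exists_sum_fsmul_eq [SigmaCompactSpace M] {k : ℕ} {Y : ι → sections 𝕂 𝔨 E F L k}
    (hY : ∀ x, RealSpans 𝕂 fun i => (Y i).1 x) (X : sections 𝕂 𝔨 E F L k) :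
    ∃ f : ι → C^(k : ℕ∞)⟮𝓘(ℝ, E), M; ℝ⟯, ∑ i, fsmul (f i) (Y i) = X := by
  have hfd : FiniteDimensional ℝ F := FiniteDimensional.trans ℝ 𝕂 F
  have hk_top : ((k : ℕ∞) : ℕ∞ω) ≤ (∞ : ℕ∞ω) := by exact_mod_cast le_top
  have hman : IsManifold 𝓘(ℝ, E) (k : ℕ∞) M := IsManifold.of_le hk_top
  -- The admissible coefficients at each point form an affine subspace, so local `C^k`-choices can
  -- be glued by a partition of unity.
  obtain ⟨g, hg⟩ := exists_contMDiffMap_forall_mem_convex_of_local 𝓘(ℝ, E) (n := (k : ℕ∞))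
    (t := fun x => {t : ι → ℝ | ∑ i, (t i : 𝕂) • (Y i).1 x = X.1 x})
    (fun x t ht s hs a b _ _ hab => by
      simp only [mem_ofPred_eq, Pi.add_apply, Pi.smul_apply, smul_eq_mul, RCLike.ofReal_add,
        RCLike.ofReal_mul, add_smul, mul_smul, Finset.sum_add_distrib, ← Finset.smul_sum] at *
      rw [ht, hs, ← add_smul, ← RCLike.ofReal_add, hab, RCLike.ofReal_one, one_smul])
    (fun x => by
      obtain ⟨e, hx, he⟩ := IsLieAlgebraBundle.exists_isLieChart (𝕂 := 𝕂) (𝔨 := 𝔨) (E := E)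
        (F := F) (L := L) x
      have hb := he.toIsBundleChart
      obtain ⟨g, hgs, hg⟩ := exists_contDiffAt_coefficients ((hb.realSpans_iff hx _).1 (hY x))
      have hz : ContMDiffAt 𝓘(ℝ, E) 𝓘(ℝ, ι → F) (k : ℕ∞)
          (fun y => fun i => (e ⟨y, (Y i).1 y⟩).2) x :=
        contMDiffAt_pi_space.2 fun i => contMDiffAt_localForm (Y i) hb hx
      have h1 : ContMDiffAt 𝓘(ℝ, E) 𝓘(ℝ, ι → ℝ) (k : ℕ∞)
          (fun y => g (fun i => (e ⟨y, (Y i).1 y⟩).2) (e ⟨y, X.1 y⟩).2) x :=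
        ((hgs.of_le hk_top).contMDiffAt.comp x hz).clm_apply (contMDiffAt_localForm X hb hx)
      obtain ⟨U, hU, hgU⟩ := (contMDiffAt_iff_contMDiffOn_nhds (by simp)).1 h1
      refine ⟨U ∩ {y | y ∈ e.baseSet ∧ ∀ v, ∑ i, g (fun i => (e ⟨y, (Y i).1 y⟩).2) v i •
        (e ⟨y, (Y i).1 y⟩).2 = v}, inter_mem hU (inter_mem (e.open_baseSet.mem_nhds hx)
          (hz.continuousAt.eventually hg)), _, hgU.mono inter_subset_left, ?_⟩
      rintro y ⟨-, hy, hyg⟩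
      apply (hb.fibreEquiv hy).injective
      rw [map_sum]
      simp only [hb.fibreEquiv_ofReal_smul]
      exact hyg _)
  refine ⟨fun i => ⟨fun x => g x i, contMDiff_pi_space.1 g.contMDiff i⟩, sections_ext fun x => ?_⟩
  rw [sum_apply]
  exact hg x

/-- If `𝔨` is perfect, so is the Lie algebra of sections. -/
theorem mem_span_lie_of_perfect [SigmaCompactSpace M] {k : ℕ}
    (h : ⁅(⊤ : LieIdeal 𝕂 𝔨), (⊤ : LieIdeal 𝕂 𝔨)⁆ = ⊤) (X : sections 𝕂 𝔨 E F L k) :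
    X ∈ Submodule.span 𝕂
      (range fun p : sections 𝕂 𝔨 E F L k × sections 𝕂 𝔨 E F L k => ⁅p.1, p.2⁆) := by
  obtain ⟨N, Z, hZ⟩ := exists_sections_realSpans 𝕂 𝔨 E F L
  let Y : Fin N → sections 𝕂 𝔨 E F L k := fun i =>
    ⟨(Z i).1, fun x => ((Z i).2 x).of_le (by exact_mod_cast le_top)⟩
  obtain ⟨f, rfl⟩ := exists_sum_fsmul_eq (Y := fun p : Fin N × Fin N => ⁅Y p.1, Y p.2⁆)
    (fun x => by
      obtain ⟨φ⟩ := exists_lieEquiv 𝕂 𝔨 E F L x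
      exact (hZ x).lie (span_lie_eq_top φ h)) X
  -- Each term is a single bracket, since `f [Y, Y'] = [f Y, Y']`.
  refine Submodule.sum_mem _ fun p _ => Submodule.subset_span ⟨(fsmul (f p) (Y p.1), Y p.2), ?_⟩
  exact fsmul_lie _ _ _

theorem derivation_fsmul_of_perfect_or_centerfree [SigmaCompactSpace M] {k : ℕ}
    (h : ⁅(⊤ : LieIdeal 𝕂 𝔨), (⊤ : LieIdeal 𝕂 𝔨)⁆ = ⊤ ∨ LieAlgebra.center 𝕂 𝔨 = ⊥)
    (D : LieDerivation 𝕂 (sections 𝕂 𝔨 E F L k) (sections 𝕂 𝔨 E F L k))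
    (f : C^(k : ℕ∞)⟮𝓘(ℝ, E), M; ℝ⟯) (X : sections 𝕂 𝔨 E F L k) :
    D (fsmul f X) = fsmul f (D X) := by
  refine derivation_fsmul D (fun f g X => ?_) f X
  rcases h with h | h
  · exact defect_fsmul_of_span D (mem_span_lie_of_perfect h) f g X
  · refine defect_fsmul_of_center D (fun x v hv => ?_) f g X
    obtain ⟨φ⟩ := exists_lieEquiv 𝕂 𝔨 E F L x
    exact eq_zero_of_center_eq_bot φ h v hv

end Generic

end LieAlgebraBundle

end

/-! ### Conclusion. -/

theorem mainTheorem5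
    {𝕂 : Type*} [RCLike 𝕂]
    -- the finite-dimensional Lie algebra `𝔨`
    {𝔨 : Type*} [LieRing 𝔨] [LieAlgebra 𝕂 𝔨] [FiniteDimensional 𝕂 𝔨]
    -- the manifold `M`
    {E : Type*} [NormedAddCommGroup E] [NormedSpace ℝ E] [FiniteDimensional ℝ E]
    {M : Type*} [TopologicalSpace M] [ChartedSpace E M] [IsManifold 𝓘(ℝ, E) ∞ M]
    [T2Space M] [ParacompactSpace M] [ConnectedSpace M]
    -- the model fibre
    {F : Type*} [NormedAddCommGroup F] [NormedSpace ℝ F] [NormedSpace 𝕂 F]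
    [IsScalarTower ℝ 𝕂 F] [FiniteDimensional 𝕂 F]
    -- the bundle of Lie algebras
    {L : M → Type*} [∀ x, LieRing (L x)] [∀ x, LieAlgebra 𝕂 (L x)]
    [∀ x, Module ℝ (L x)] [∀ x, IsScalarTower ℝ 𝕂 (L x)]
    [∀ x, TopologicalSpace (L x)] [TopologicalSpace (TotalSpace F L)]
    [FiberBundle F L] [VectorBundle ℝ F L] [ContMDiffVectorBundle ∞ F L 𝓘(ℝ, E)]
    [LieAlgebraBundle.IsLieAlgebraBundle 𝕂 𝔨 E F L]
    (k : ℕ)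
    (h𝔨 : ⁅(⊤ : LieIdeal 𝕂 𝔨), (⊤ : LieIdeal 𝕂 𝔨)⁆ = ⊤ ∨ LieAlgebra.center 𝕂 𝔨 = ⊥) :
    -- every derivation is local
    (∀ D : LieDerivation 𝕂 (LieAlgebraBundle.sections 𝕂 𝔨 E F L k)
        (LieAlgebraBundle.sections 𝕂 𝔨 E F L k),
      LieAlgebraBundle.IsLocalOperator D.toLinearMap) ∧
    -- every derivation is a differential operator of order zero
    (∀ D : LieDerivation 𝕂 (LieAlgebraBundle.sections 𝕂 𝔨 E F L k)
        (LieAlgebraBundle.sections 𝕂 𝔨 E F L k),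
      LieAlgebraBundle.IsDiffOpOrderZero D.toLinearMap) ∧
    -- the resulting isomorphism of Lie algebras
    ∃ Ψ : LieDerivation 𝕂 (LieAlgebraBundle.sections 𝕂 𝔨 E F L k)
        (LieAlgebraBundle.sections 𝕂 𝔨 E F L k) ≃ₗ⁅𝕂⁆
          LieAlgebraBundle.derSections 𝕂 𝔨 E F L k,
      ∀ (D : LieDerivation 𝕂 (LieAlgebraBundle.sections 𝕂 𝔨 E F L k)
          (LieAlgebraBundle.sections 𝕂 𝔨 E F L k))
        (X : LieAlgebraBundle.sections 𝕂 𝔨 E F L k) (x : M),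
        (Ψ D).1 x (X.1 x) = (D X).1 x := by
  have : LocallyCompactSpace M := ChartedSpace.locallyCompactSpace E M
  have : SigmaCompactSpace M := sigmaCompactSpace_of_connected_paracompact M
  have hpt : ∀ (D : LieDerivation 𝕂 (LieAlgebraBundle.sections 𝕂 𝔨 E F L k)
      (LieAlgebraBundle.sections 𝕂 𝔨 E F L k)) (X : LieAlgebraBundle.sections 𝕂 𝔨 E F L k) (x : M),
      X.1 x = 0 → (D X).1 x = 0 := fun D X x =>
    LieAlgebraBundle.derivation_apply_eq_zero D
      (LieAlgebraBundle.derivation_fsmul_of_perfect_or_centerfree h𝔨 D) X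
  exact ⟨fun D X U _ hX x hx => hpt D X x (hX x hx),
    LieAlgebraBundle.isDiffOpOrderZero_of_pointwise hpt,
    LieAlgebraBundle.derivationEquiv hpt, LieAlgebraBundle.derivationEquiv_apply hpt⟩
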